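/- For $p\in(0,1/2)$ let $c_p>0$ be the unique real number with $\mathbb{P}[Z\le -c_p]=p$, where $Z\sim\mathcal N(0,1)$. For positive integers $n,d$, the Gaussian random geometric graph $G(n,d,p)$ has vertex set $[n]$; its vertices correspond to independent random vectors $\boldsymbol x_1,\dots,\boldsymbol x_n\sim\mathcal N(0,\frac1d I_d)$ in $\mathbb R^d$, and distinct $i,j$ are joined by an edge if and only if $\langle\boldsymbol x_i,\boldsymbol x_j\rangle\ge -c_p/\sqrt d$. Edges are coloured blue and non-edges red; write $P_{\mathrm{red},r}=\mathbb P[G(r,d,p)\text{ is an independent set}]$ and $P_{\mathrm{blue},r}=\mathbb P[G(r,d,p)\text{ is a clique}]$. Lemma 3. Let $C>1$ be a constant and let $p_C\in(0,1/2)$ be the unique solution of $C=\frac{\log p_C}{\log(1-p_C)}$. There is $D_0=D_0(C)>0$ such that for every real $D\ge D_0$ there exist $\varepsilon_1\in(0,p_C)$ and $p\in(0,1/2)$, depending only on $C$ and $D$, such that for all integers $\ell$ that are sufficiently large in terms of $C$ and $D$, with $d=D^2\ell^2$, $$P_{\mathrm{red},\ell}\le (p_C-\varepsilon_1)^{\binom{\ell}{2}}\quad\text{and}\quad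 P_{\mathrm{blue},C\ell}\le(1-p_C-\varepsilon_1)^{\binom{C\ell}{2}}.$$ Where $D^2\ell^2$ or $C\ell$ is not an integer, it may be replaced by either of the two integers nearest to it from below and above. -/

import Mathlib

open MeasureTheory ProbabilityTheory

namespace GaussRamsey

/-! ### The Erdős probability `p_C` -/

/-- `q` lies in `(0, 1/2)` and solves `C = log q / log (1 - q)`. -/
def IsErdosProb (C q : ℝ) : Prop :=
  0 < q ∧ q < 1 / 2 ∧ C = Real.log q / Real.log (1 - q)

theorem isErdosProb_iff {C q : ℝ} (h0 : 0 < q) (h1 : q < 1 / 2) :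
    IsErdosProb C q ↔ Real.log q - C * Real.log (1 - q) = 0 := by
  have hl : Real.log (1 - q) < 0 := Real.log_neg (by linarith) (by linarith)
  unfold IsErdosProb
  rw [eq_div_iff hl.ne]
  constructor
  · rintro ⟨-, -, h⟩
    linarith
  · intro h
    exact ⟨h0, h1, by linarith⟩

theorem existsUnique_isErdosProb {C : ℝ} (hC : 1 < C) : ∃! q : ℝ, IsErdosProb C q := by
  have hl2 : 0 < Real.log 2 := Real.log_pos (by norm_num)
  have hhalf : Real.log (1 / 2) = -Real.log 2 := by rw [one_div, Real.log_inv]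
  let g : ℝ → ℝ := fun q => Real.log q - C * Real.log (1 - q)
  have hmono : ∀ x y : ℝ, 0 < x → x < y → y ≤ 1 / 2 → g x < g y := by
    intro x y hx hxy hy
    have h1 : Real.log x < Real.log y := Real.log_lt_log hx hxy
    have h2 : Real.log (1 - y) < Real.log (1 - x) :=
      Real.log_lt_log (by linarith) (by linarith)
    simp only [g]
    nlinarith
  let q₀ : ℝ := Real.exp (-(C + 1) * Real.log 2)
  have hq₀ : 0 < q₀ := Real.exp_pos _
  have hlq₀ : Real.log q₀ = -(C + 1) * Real.log 2 := Real.log_exp _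
  have hq₀' : q₀ < 1 / 2 := by
    rw [← Real.log_lt_log_iff hq₀ (by norm_num), hlq₀, hhalf]
    nlinarith
  have hg0 : g q₀ < 0 := by
    have : Real.log (1 / 2) ≤ Real.log (1 - q₀) :=
      Real.log_le_log (by norm_num) (by linarith)
    simp only [g]
    rw [hlq₀]
    rw [hhalf] at this
    nlinarith
  have hg1 : 0 < g (1 / 2) := by
    simp only [g]
    rw [show (1 - 1 / 2 : ℝ) = 1 / 2 by norm_num, hhalf]
    nlinarith
  have hcont : ContinuousOn g (Set.Icc q₀ (1 / 2)) := by
    apply ContinuousOn.sub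
    · exact Real.continuousOn_log.mono fun x hx => (lt_of_lt_of_le hq₀ hx.1).ne'
    · refine continuousOn_const.mul (ContinuousOn.log (by fun_prop) ?_)
      intro x hx
      have := hx.2
      linarith
  obtain ⟨q, hq, hgq⟩ := intermediate_value_Ioo hq₀'.le hcont ⟨hg0, hg1⟩
  have hqpos : 0 < q := hq₀.trans hq.1
  refine ⟨q, (isErdosProb_iff hqpos hq.2).2 hgq, ?_⟩
  intro y hy
  have hgy : g y = 0 := (isErdosProb_iff hy.1 hy.2.1).1 hy
  rcases lt_trichotomy y q with h | h | h
  · have := hmono y q hy.1 h hq.2.le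
    linarith
  · exact h
  · have := hmono q y hqpos h hy.2.1.le
    linarith

/-- `p_C`: the solution `q ∈ (0, 1/2)` of `C = log q / log (1 - q)`. -/
noncomputable def erdosProb (C : ℝ) : ℝ :=
  Classical.epsilon fun q : ℝ => IsErdosProb C q

theorem erdosProb_spec {C : ℝ} (hC : 1 < C) : IsErdosProb C (erdosProb C) :=
  Classical.epsilon_spec (existsUnique_isErdosProb hC).exists

/-! ### The threshold `c_p` -/

/-- `c > 0` and `P[Z ≤ -c] = p` for a standard normal variable `Z`. -/
def IsGaussThreshold (p c : ℝ) : Prop :=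
  0 < c ∧ (gaussianReal 0 1).real (Set.Iic (-c)) = p

theorem gaussianReal_Iic_strictMono :
    StrictMono fun x : ℝ => (gaussianReal 0 1).real (Set.Iic x) := by
  intro x y hxy
  have hpos : 0 < (gaussianReal 0 1).real (Set.Ioc x y) := by
    refine ENNReal.toReal_pos ?_ (measure_ne_top _ _)
    intro h0
    have := gaussianReal_absolutelyContinuous' 0 one_ne_zero h0
    rw [Real.volume_Ioc, ENNReal.ofReal_eq_zero] at this
    linarith
  have hsplit : (gaussianReal 0 1).real (Set.Iic y)
      = (gaussianReal 0 1).real (Set.Iic x) + (gaussianReal 0 1).real (Set.Ioc x y) := by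
    rw [← measureReal_union _ measurableSet_Ioc, Set.Iic_union_Ioc_eq_Iic hxy.le]
    exact Set.disjoint_left.2 fun z hz hz' => not_lt.2 hz hz'.1
  simp only
  linarith

theorem gaussianReal_Iic_continuous :
    Continuous fun x : ℝ => (gaussianReal 0 1).real (Set.Iic x) := by
  have hcdf : (fun x : ℝ => (gaussianReal 0 1).real (Set.Iic x)) = cdf (gaussianReal 0 1) := by
    funext x
    exact (cdf_eq_real _ x).symm
  rw [hcdf, continuous_iff_continuousAt]
  intro x
  have hna := nullSingletonClass_gaussianReal (μ := 0) (v := 1) one_ne_zero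
  have h : (cdf (gaussianReal 0 1)).measure {x} = 0 := by
    rw [measure_cdf]
    exact measure_singleton x
  rw [StieltjesFunction.measure_singleton, ENNReal.ofReal_eq_zero] at h
  rw [(monotone_cdf _).continuousAt_iff_leftLim_eq_rightLim, StieltjesFunction.rightLim_eq]
  exact le_antisymm ((monotone_cdf _).leftLim_le le_rfl) (by linarith)

theorem gaussianReal_Iic_zero : (gaussianReal 0 1).real (Set.Iic 0) = 1 / 2 := by
  have hna := nullSingletonClass_gaussianReal (μ := 0) (v := 1) one_ne_zero
  have h1 : (gaussianReal 0 1).real (Set.Iic 0) = (gaussianReal 0 1).real (Set.Ioi 0) := by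
    have hneg : (gaussianReal 0 1).map (fun x : ℝ => -x) = gaussianReal 0 1 := by
      rw [gaussianReal_map_neg, neg_zero]
    calc (gaussianReal 0 1).real (Set.Iic 0)
        = ((gaussianReal 0 1).map (fun x : ℝ => -x)).real (Set.Iic 0) := by rw [hneg]
      _ = (gaussianReal 0 1).real (Set.Ici 0) := by
          rw [map_measureReal_apply measurable_neg measurableSet_Iic]
          congr 1
          ext z
          simp
      _ = (gaussianReal 0 1).real (Set.Ioi 0) := measureReal_congr Ioi_ae_eq_Ici.symm
  have h2 : (gaussianReal 0 1).real (Set.Iic 0) + (gaussianReal 0 1).real (Set.Ioi 0) = 1 := by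
    rw [← Set.compl_Iic, probReal_compl_eq_one_sub measurableSet_Iic]
    ring
  linarith

theorem existsUnique_isGaussThreshold {p : ℝ} (h0 : 0 < p) (h1 : p < 1 / 2) :
    ∃! c : ℝ, IsGaussThreshold p c := by
  have hlim : Filter.Tendsto (fun x : ℝ => (gaussianReal 0 1).real (Set.Iic x))
      Filter.atBot (nhds 0) := by
    refine (tendsto_cdf_atBot (gaussianReal 0 1)).congr fun x => cdf_eq_real _ x
  obtain ⟨x₀, hx₀, hx₀'⟩ :=
    ((hlim.eventually (gt_mem_nhds h0)).and (Filter.eventually_lt_atBot 0)).exists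
  obtain ⟨x, hx, hpx⟩ := intermediate_value_Ioo hx₀'.le gaussianReal_Iic_continuous.continuousOn
    ⟨hx₀, lt_of_lt_of_eq h1 gaussianReal_Iic_zero.symm⟩
  refine ⟨-x, ⟨by have := hx.2; linarith, by simpa using hpx⟩, ?_⟩
  intro y hy
  have := gaussianReal_Iic_strictMono.injective (hy.2.trans hpx.symm)
  linarith

/-- `c_p`: the number `c > 0` with `P[Z ≤ -c] = p`, where `Z ∼ N(0, 1)`. -/
noncomputable def gaussThreshold (p : ℝ) : ℝ :=
  Classical.epsilon fun c : ℝ => IsGaussThreshold p c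

theorem gaussThreshold_spec {p : ℝ} (h0 : 0 < p) (h1 : p < 1 / 2) :
    IsGaussThreshold p (gaussThreshold p) :=
  Classical.epsilon_spec (existsUnique_isGaussThreshold h0 h1).exists

/-! ### The Gaussian random geometric graph `G(n, d, p)` -/

/-- The graph on `[n]` of the vectors `x 1, …, x n ∈ ℝ^d`: distinct `i`, `j` are adjacent if
`⟨x i, x j⟩ ≥ -c_p / √d`. -/
def geomGraph (n d : ℕ) (p : ℝ) (x : Fin n → EuclideanSpace ℝ (Fin d)) :
    SimpleGraph (Fin n) where
  Adj i j := i ≠ j ∧ -(gaussThreshold p) / Real.sqrt d ≤ inner ℝ (x i) (x j)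
  symm := ⟨fun i j h => ⟨h.1.symm, by rw [real_inner_comm]; exact h.2⟩⟩
  loopless := ⟨fun _ h => h.1 rfl⟩

/-- The joint law of `n` independent vectors with distribution `N(0, (1/d) I_d)`. -/
noncomputable def gaussVectors (n d : ℕ) : Measure (Fin n → EuclideanSpace ℝ (Fin d)) :=
  Measure.pi fun _ =>
    multivariateGaussian (0 : EuclideanSpace ℝ (Fin d))
      ((1 / (d : ℝ)) • (1 : Matrix (Fin d) (Fin d) ℝ))

/-- `P_{red, r}`: the probability that all of `G(r, d, p)` is an independent set
(non-edges are red). -/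
noncomputable def probRed (r d : ℕ) (p : ℝ) : ℝ :=
  (gaussVectors r d).real {x | (geomGraph r d p x).IsIndepSet Set.univ}

/-- `P_{blue, r}`: the probability that all of `G(r, d, p)` is a clique (edges are blue). -/
noncomputable def probBlue (r d : ℕ) (p : ℝ) : ℝ :=
  (gaussVectors r d).real {x | (geomGraph r d p x).IsClique Set.univ}

end GaussRamsey

namespace GaussRamsey

open scoped ENNReal

/-! ### One-dimensional Gaussian estimates -/

/-! Both probabilities are bounded by exposing the vectors one at a time. Rescale to standard
Gaussians and rotate the exposed vector onto an axis. It constrains the coordinates `z j` of the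
other vectors along that axis, and what is left of them must satisfy the same kind of pair
constraints in one dimension less, with `A i j` replaced by `A i j - σ * (z i * z j)`
(`pairEvent_succ_le`). The induction closes for bounds that are exponential in a linear function of
the `A i j` (`measure_pairEvent_le`). Such bounds exist because Φ is log-concave: `log Φ` is
replaced by its tangent at `θ`, of slope `m = hazard θ`.

To leading order every pair contributes an independent factor Φ(θ). The next order is the point of
the argument. A coordinate conditioned on `z ≤ θ` has mean `-m`, so the products `z i * z j` are
typically near `m ^ 2`, and each exposure pushes later inner products upwards in both colours. Red
sets become rarer and blue ones more frequent: with `n` vectors in dimension `d`, the exponent per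
pair changes by about `-m³n/(3√d)` for red and `+m³n/(3√d)` for blue (`layerBound_red`,
`layerBound_blue`).

Let `c` be the threshold of `p_C`, let `a = hazard (-c)` and `b = hazard c`, and shift the threshold
to `c - η/D`. The exponents per pair then move by `a(η - a²/3)/D` for red and `b(Cb²/3 - η)/D` for
blue, up to order `1/D²`. Some `η` makes both negative precisely when `C * b ^ 2 < a ^ 2`; since `a
* p_C = b * (1 - p_C)`, this is `erdosProb_sq_lt`. A large `D` absorbs the second-order terms. The
remaining errors are bounded per layer, hence vanish per pair as `ℓ → ∞`. -/

/-- The standard normal distribution function. -/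
noncomputable def gaussCDF (x : ℝ) : ℝ := (gaussianReal 0 1).real (Set.Iic x)

theorem gaussCDF_pos (x : ℝ) : 0 < gaussCDF x := by
  have h := gaussianReal_Iic_strictMono (show x - 1 < x by linarith)
  exact lt_of_le_of_lt measureReal_nonneg h

theorem gaussCDF_lt_one (x : ℝ) : gaussCDF x < 1 := by
  have h := gaussianReal_Iic_strictMono (show x < x + 1 by linarith)
  exact lt_of_lt_of_le h measureReal_le_one

theorem gaussCDF_neg (x : ℝ) : gaussCDF (-x) = 1 - gaussCDF x := by
  have hna := nullSingletonClass_gaussianReal (μ := 0) (v := 1) one_ne_zero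
  have h1 : gaussCDF (-x) = (gaussianReal 0 1).real (Set.Ioi x) := by
    have hneg : (gaussianReal 0 1).map (fun x : ℝ => -x) = gaussianReal 0 1 := by
      rw [gaussianReal_map_neg, neg_zero]
    calc (gaussianReal 0 1).real (Set.Iic (-x))
        = ((gaussianReal 0 1).map (fun x : ℝ => -x)).real (Set.Iic (-x)) := by rw [hneg]
      _ = (gaussianReal 0 1).real (Set.Ici x) := by
          rw [map_measureReal_apply measurable_neg measurableSet_Iic]
          congr 1
          ext z
          simp
      _ = (gaussianReal 0 1).real (Set.Ioi x) := measureReal_congr Ioi_ae_eq_Ici.symm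
  rw [h1, gaussCDF, ← Set.compl_Iic, probReal_compl_eq_one_sub measurableSet_Iic]

theorem gaussianReal_eq_map_affine (y t : ℝ) :
    gaussianReal y (Real.toNNReal (t ^ 2)) = (gaussianReal 0 1).map (fun z => t * z + y) := by
  have h : (fun z : ℝ => t * z + y) = (fun z => z + y) ∘ (fun z => t * z) := rfl
  rw [h, ← Measure.map_map (by fun_prop) (by fun_prop), gaussianReal_map_const_mul,
    gaussianReal_map_add_const]
  congr 1
  · simp
  · ext
    simp [sq_nonneg]

/-- Multiplying the standard Gaussian density by `exp (s z + (1 - q²) z² / 2)` gives a multiple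
of the density of `N(s/q², 1/q²)`. -/
theorem lintegral_gaussian_tilt {q : ℝ} (hq : 0 < q) (s : ℝ) {f : ℝ → ℝ≥0∞} (hf : Measurable f) :
    ∫⁻ z, f z * ENNReal.ofReal (Real.exp (s * z + (1 - q ^ 2) / 2 * z ^ 2)) ∂gaussianReal 0 1
      = ENNReal.ofReal (q⁻¹ * Real.exp (s ^ 2 / (2 * q ^ 2))) *
        ∫⁻ z, f (q⁻¹ * z + s / q ^ 2) ∂gaussianReal 0 1 := by
  have hm : ∫⁻ z, f (q⁻¹ * z + s / q ^ 2) ∂gaussianReal 0 1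
      = ∫⁻ z, f z ∂gaussianReal (s / q ^ 2) (Real.toNNReal (q⁻¹ ^ 2)) := by
    rw [gaussianReal_eq_map_affine, lintegral_map hf (by fun_prop)]
  have hv : Real.toNNReal (q⁻¹ ^ 2) ≠ 0 := by
    rw [Ne, Real.toNNReal_eq_zero, not_le]
    positivity
  rw [hm, gaussianReal_of_var_ne_zero _ one_ne_zero, gaussianReal_of_var_ne_zero _ hv,
    lintegral_withDensity_eq_lintegral_mul _ (by fun_prop) (by fun_prop),
    lintegral_withDensity_eq_lintegral_mul _ (by fun_prop) (by fun_prop),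
    ← lintegral_const_mul _ (by fun_prop)]
  congr 1
  ext z
  simp only [Pi.mul_apply, gaussianPDF_def]
  rw [mul_comm (f z), ← mul_assoc, ← mul_assoc, ← ENNReal.ofReal_mul (gaussianPDFReal_nonneg _ _ _),
    ← ENNReal.ofReal_mul (by positivity)]
  congr 2
  rw [gaussianPDFReal_def, gaussianPDFReal_def]
  simp only [NNReal.coe_one, mul_one, sub_zero, Real.coe_toNNReal _ (sq_nonneg q⁻¹)]
  have h1 : √(2 * Real.pi * q⁻¹ ^ 2) = √(2 * Real.pi) * q⁻¹ := by
    rw [Real.sqrt_mul (by positivity), Real.sqrt_sq (by positivity)]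
  rw [h1]
  have h2 : -(z - s / q ^ 2) ^ 2 / (2 * q⁻¹ ^ 2) + s ^ 2 / (2 * q ^ 2)
      = -z ^ 2 / 2 + (s * z + (1 - q ^ 2) / 2 * z ^ 2) := by
    field_simp
    ring
  rw [mul_assoc, ← Real.exp_add, ← h2, Real.exp_add]
  field_simp

theorem lintegral_gaussian_exp {q : ℝ} (hq : 0 < q) (s : ℝ) :
    ∫⁻ z, ENNReal.ofReal (Real.exp (s * z + (1 - q ^ 2) / 2 * z ^ 2)) ∂gaussianReal 0 1
      = ENNReal.ofReal (q⁻¹ * Real.exp (s ^ 2 / (2 * q ^ 2))) := by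
  have h := lintegral_gaussian_tilt hq s (f := fun _ => 1) measurable_const
  simpa using h

theorem setLIntegral_Iic_gaussian_exp {q : ℝ} (hq : 0 < q) (s v : ℝ) :
    ∫⁻ z in Set.Iic v, ENNReal.ofReal (Real.exp (s * z + (1 - q ^ 2) / 2 * z ^ 2)) ∂gaussianReal 0 1
      = ENNReal.ofReal (q⁻¹ * Real.exp (s ^ 2 / (2 * q ^ 2)) * gaussCDF (q * v - s / q)) := by
  have h := lintegral_gaussian_tilt hq s (f := (Set.Iic v).indicator 1)
    (measurable_one.indicator measurableSet_Iic)
  rw [ENNReal.ofReal_mul (by positivity), gaussCDF, ofReal_measureReal]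
  rw [← lintegral_indicator measurableSet_Iic]
  convert h using 2
  · ext z
    by_cases hz : z ∈ Set.Iic v <;> simp [hz]
  · rw [← lintegral_indicator_one measurableSet_Iic]
    congr 1
    ext z
    have : z ∈ Set.Iic (q * v - s / q) ↔ q⁻¹ * z + s / q ^ 2 ∈ Set.Iic v := by
      simp only [Set.mem_Iic]
      have e : v - (q⁻¹ * z + s / q ^ 2) = q⁻¹ * (q * v - s / q - z) := by
        field_simp
        ring
      rw [← sub_nonneg, ← sub_nonneg (b := q⁻¹ * z + s / q ^ 2), e,
        mul_nonneg_iff_of_pos_left (by positivity)]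
    by_cases hz : z ∈ Set.Iic (q * v - s / q)
    · simp [hz, this.1 hz]
    · rw [Set.indicator_of_notMem hz, Set.indicator_of_notMem (fun h => hz (this.2 h))]

/-- Chernoff bound for the lower tail. -/
theorem gaussCDF_le_exp {b : ℝ} (hb : 0 ≤ b) (x : ℝ) :
    gaussCDF x ≤ Real.exp (b * x + b ^ 2 / 2) := by
  have h1 := lintegral_gaussian_exp one_pos (-b)
  have h2 : (gaussianReal 0 1) (Set.Iic x) * ENNReal.ofReal (Real.exp (-b * x))
      ≤ ENNReal.ofReal (Real.exp (b ^ 2 / 2)) := by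
    calc (gaussianReal 0 1) (Set.Iic x) * ENNReal.ofReal (Real.exp (-b * x))
        = ∫⁻ z in Set.Iic x, ENNReal.ofReal (Real.exp (-b * x)) ∂gaussianReal 0 1 := by
          rw [setLIntegral_const, mul_comm]
      _ ≤ ∫⁻ z in Set.Iic x, ENNReal.ofReal (Real.exp (-b * z + (1 - 1 ^ 2) / 2 * z ^ 2))
            ∂gaussianReal 0 1 := by
          refine setLIntegral_mono (by fun_prop) fun z hz => ?_
          apply ENNReal.ofReal_le_ofReal
          apply Real.exp_le_exp.2
          have : z ≤ x := hz
          nlinarith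
      _ ≤ _ := setLIntegral_le_lintegral _ _
      _ = _ := by rw [h1]; simp
  rw [← ofReal_measureReal, ← ENNReal.ofReal_mul measureReal_nonneg,
    ENNReal.ofReal_le_ofReal_iff (by positivity)] at h2
  rw [Real.exp_add]
  have h3 : gaussCDF x * Real.exp (-b * x) * Real.exp (b * x)
      ≤ Real.exp (b ^ 2 / 2) * Real.exp (b * x) := by
    gcongr
    exact h2
  rw [mul_assoc, ← Real.exp_add] at h3
  simp only [neg_mul, neg_add_cancel, Real.exp_zero, mul_one] at h3
  linarith

/-- Translating the integrand fixes the domain of integration, so that values of Φ at different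
points can be compared pointwise under the integral. -/
theorem gaussCDF_eq_integral (x : ℝ) :
    gaussCDF x = ∫ w in Set.Iic 0, gaussianPDFReal 0 1 (w + x) := by
  rw [gaussCDF, measureReal_def, gaussianReal_apply_eq_integral _ one_ne_zero,
    ENNReal.toReal_ofReal (integral_nonneg fun _ => gaussianPDFReal_nonneg _ _ _)]
  have h := (measurePreserving_add_right volume x).setIntegral_preimage_emb
    (measurableEmbedding_addRight x) (gaussianPDFReal 0 1) (Set.Iic x)
  rw [← h]
  simp

theorem gaussCDF_hasDerivAt (x : ℝ) : HasDerivAt gaussCDF (gaussianPDFReal 0 1 x) x := by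
  have hc : Continuous (gaussianPDFReal 0 1) := by
    rw [gaussianPDFReal_def]
    fun_prop
  have h : gaussCDF = fun x => gaussCDF 0 + ∫ w in (0 : ℝ)..x, gaussianPDFReal 0 1 w := by
    ext x
    have e : ∀ x, gaussCDF x = ∫ w in Set.Iic x, gaussianPDFReal 0 1 w := by
      intro x
      rw [gaussCDF, measureReal_def, gaussianReal_apply_eq_integral _ one_ne_zero,
        ENNReal.toReal_ofReal (integral_nonneg fun _ => gaussianPDFReal_nonneg _ _ _)]
    have := intervalIntegral.integral_Iic_sub_Iic (a := 0) (b := x)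
      (integrable_gaussianPDFReal 0 1).integrableOn (integrable_gaussianPDFReal 0 1).integrableOn
    rw [e, e, ← this]
    ring
  rw [h]
  exact (intervalIntegral.integral_hasDerivAt_right (hc.intervalIntegrable _ _)
    hc.stronglyMeasurable.stronglyMeasurableAtFilter hc.continuousAt).const_add _

/-- The Gaussian hazard rate `φ / Φ` is antitone. -/
theorem gaussCDF_hazard {x y : ℝ} (hxy : x ≤ y) :
    gaussianPDFReal 0 1 y * gaussCDF x ≤ gaussianPDFReal 0 1 x * gaussCDF y := by
  have hi : ∀ y : ℝ, Integrable (fun w => gaussianPDFReal 0 1 (w + y)) :=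
    fun y => (integrable_gaussianPDFReal 0 1).comp_add_right y
  rw [gaussCDF_eq_integral, gaussCDF_eq_integral, ← integral_const_mul, ← integral_const_mul]
  refine setIntegral_mono_on ((hi x).const_mul _).integrableOn ((hi y).const_mul _).integrableOn
    measurableSet_Iic fun w hw => ?_
  have hw : w ≤ 0 := hw
  simp only [gaussianPDFReal_def, NNReal.coe_one, mul_one, sub_zero]
  -- The two exponents differ by `w * (x - y)`, which is nonnegative because `w ≤ 0` and `x ≤ y`.
  have h : Real.exp (-y ^ 2 / 2) * Real.exp (-(w + x) ^ 2 / 2)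
      ≤ Real.exp (-x ^ 2 / 2) * Real.exp (-(w + y) ^ 2 / 2) := by
    rw [← Real.exp_add, ← Real.exp_add, Real.exp_le_exp]
    nlinarith
  have h0 : 0 ≤ (√(2 * Real.pi))⁻¹ * (√(2 * Real.pi))⁻¹ := by positivity
  have := mul_le_mul_of_nonneg_left h h0
  linarith

/-- The slope of `log Φ` at `θ`. -/
noncomputable def hazard (θ : ℝ) : ℝ := gaussianPDFReal 0 1 θ / gaussCDF θ

theorem hazard_pos (θ : ℝ) : 0 < hazard θ :=
  div_pos (gaussianPDFReal_pos _ _ _ one_ne_zero) (gaussCDF_pos θ)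

theorem hazard_antitone : Antitone hazard := by
  intro x y hxy
  unfold hazard
  rw [div_le_div_iff₀ (gaussCDF_pos _) (gaussCDF_pos _)]
  exact gaussCDF_hazard hxy

/-- The distribution function is log-concave: it lies below its logarithmic tangent lines. -/
theorem gaussCDF_le_tangent (θ x : ℝ) :
    gaussCDF x ≤ Real.exp (Real.log (gaussCDF θ) + hazard θ * (x - θ)) := by
  rw [← Real.log_le_iff_le_exp (gaussCDF_pos x)]
  let g : ℝ → ℝ := fun x => Real.log (gaussCDF x) - hazard θ * x
  have hd : ∀ x, HasDerivAt g (hazard x - hazard θ) x := by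
    intro x
    have := ((gaussCDF_hasDerivAt x).log (gaussCDF_pos x).ne').sub
      ((hasDerivAt_id x).const_mul (hazard θ))
    rw [mul_one] at this
    exact this
  have hg : g x ≤ g θ := by
    rcases le_total x θ with h | h
    · have hm : MonotoneOn g (Set.Iic θ) := by
        refine monotoneOn_of_hasDerivWithinAt_nonneg (convex_Iic θ)
          (fun y _ => (hd y).continuousAt.continuousWithinAt)
          (fun y _ => (hd y).hasDerivWithinAt) fun y hy => ?_
        have hy : y < θ := by simpa using hy
        have := hazard_antitone hy.le
        linarith
      exact hm h (Set.mem_Iic.2 le_rfl) h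
    · have hm : AntitoneOn g (Set.Ici θ) := by
        refine antitoneOn_of_hasDerivWithinAt_nonpos (convex_Ici θ)
          (fun y _ => (hd y).continuousAt.continuousWithinAt)
          (fun y _ => (hd y).hasDerivWithinAt) fun y hy => ?_
        have hy : θ < y := by simpa using hy
        have := hazard_antitone hy.le
        linarith
      exact hm (Set.mem_Ici.2 le_rfl) h h
  simp only [g] at hg
  linarith

/-- Affine upper bounds for `log Φ` with an arbitrary nonnegative slope `b`; the loss in the
constant term is Lipschitz in `b ^ 2`. -/
theorem exists_gaussCDF_le_affine (θ : ℝ) : ∃ K : ℝ, 0 < K ∧ ∀ b : ℝ, 0 ≤ b → ∀ x : ℝ,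
    gaussCDF x ≤ Real.exp (Real.log (gaussCDF θ) - hazard θ * θ + b * x
      + K * |b ^ 2 - hazard θ ^ 2|) := by
  set m := hazard θ with hm
  set Λ := Real.log (gaussCDF θ) - m * θ with hΛ
  have hm0 : 0 < m := hazard_pos θ
  -- The first summand pays for rescaling the intercept `Λ`, the second for the quadratic term of
  -- the Chernoff bound.
  refine ⟨|Λ| / m ^ 2 + 2, by positivity, fun b hb x => ?_⟩
  have ht : Real.log (gaussCDF x) ≤ Λ + m * x := by
    have := (Real.log_le_iff_le_exp (gaussCDF_pos x)).2 (gaussCDF_le_tangent θ x)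
    rw [← hm] at this
    linarith
  rw [← Real.log_le_iff_le_exp (gaussCDF_pos x)]
  have hΛ1 := neg_abs_le Λ
  rcases le_total b m with h | h
  -- Small slopes: interpolate between the trivial bound `log Φ ≤ 0` and the tangent, with weight `β
  -- = b / m` on the tangent.
  · have h0 : Real.log (gaussCDF x) ≤ 0 :=
      Real.log_nonpos (gaussCDF_pos x).le (gaussCDF_lt_one x).le
    have habs : |b ^ 2 - m ^ 2| = m ^ 2 - b ^ 2 := by
      rw [abs_of_nonpos (by nlinarith)]
      ring
    rw [habs]
    obtain ⟨β, hβ⟩ : ∃ β, b = β * m := ⟨b / m, by field_simp⟩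
    have hβ0 : 0 ≤ β := by
      by_contra hc
      nlinarith
    have hβ1 : β ≤ 1 := by
      by_contra hc
      nlinarith
    have e1 : (|Λ| / m ^ 2 + 2) * (m ^ 2 - b ^ 2) = (|Λ| + 2 * m ^ 2) * (1 - β ^ 2) := by
      rw [hβ]
      field_simp
    rw [e1]
    have h2 : Real.log (gaussCDF x) ≤ β * (Λ + m * x) := by nlinarith
    have h3 : (1 - β) * |Λ| ≤ |Λ| * (1 - β ^ 2) := by
      nlinarith [abs_nonneg Λ, mul_nonneg (abs_nonneg Λ) (mul_nonneg hβ0 (sub_nonneg.2 hβ1))]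
    have h4 : 0 ≤ 2 * m ^ 2 * (1 - β ^ 2) := by
      have : 0 ≤ 1 - β ^ 2 := by nlinarith
      positivity
    have h5 : (1 - β) * (-|Λ|) ≤ (1 - β) * Λ :=
      mul_le_mul_of_nonneg_left hΛ1 (sub_nonneg.2 hβ1)
    rw [hβ]
    nlinarith
  · have hb0 : 0 < b := lt_of_lt_of_le hm0 h
    have hc : Real.log (gaussCDF x) ≤ (2 * b) * x + (2 * b) ^ 2 / 2 :=
      (Real.log_le_iff_le_exp (gaussCDF_pos x)).2 (gaussCDF_le_exp (by positivity) x)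
    have habs : |b ^ 2 - m ^ 2| = b ^ 2 - m ^ 2 := abs_of_nonneg (by nlinarith)
    rw [habs]
    -- Large slopes: interpolate between the tangent of slope `m` and the Chernoff bound of slope `2
    -- * b`; this weight makes the mean slope equal to `b`.
    set η := (b - m) / (2 * b - m) with hη
    have hbm : 0 < 2 * b - m := by linarith
    have hη0 : 0 ≤ η := div_nonneg (by linarith) hbm.le
    have hη1 : η ≤ 1 := by
      rw [hη, div_le_one hbm]
      linarith
    have hηe : η * (2 * b - m) = b - m := div_mul_cancel₀ _ hbm.ne'
    have h1 : Real.log (gaussCDF x) ≤ (1 - η) * (Λ + m * x) + η * ((2 * b) * x + (2 * b) ^ 2 / 2) := by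
      nlinarith
    have h2 : (1 - η) * (Λ + m * x) + η * ((2 * b) * x + (2 * b) ^ 2 / 2)
        = Λ + b * x + η * (2 * b ^ 2 - Λ) := by
      linear_combination x * hηe
    have h3 : η * b ≤ b - m := by nlinarith
    have h4 : η * b ^ 2 ≤ b ^ 2 - m ^ 2 := by nlinarith
    have h5 : η * m ^ 2 ≤ b ^ 2 - m ^ 2 := by nlinarith
    have h6 : η * |Λ| ≤ |Λ| / m ^ 2 * (b ^ 2 - m ^ 2) := by
      calc η * |Λ| = |Λ| / m ^ 2 * (η * m ^ 2) := by field_simp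
        _ ≤ _ := by gcongr
    nlinarith

/-! ### Products over independent coordinates -/

theorem lintegral_pi_prod {n : ℕ} (μ : Fin n → Measure ℝ) [∀ i, SigmaFinite (μ i)]
    (f : Fin n → ℝ → ℝ≥0∞) (hf : ∀ i, Measurable (f i)) :
    ∫⁻ z, ∏ i, f i (z i) ∂Measure.pi μ = ∏ i, ∫⁻ z, f i z ∂μ i := by
  induction n with
  | zero => simp
  | succ n ih =>
    have h := (measurePreserving_piFinSuccAbove μ 0).symm
    have hm : Measurable fun z : Fin (n + 1) → ℝ => ∏ i, f i (z i) :=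
      Finset.measurable_prod _ fun i _ => (hf i).comp (measurable_pi_apply i)
    rw [← h.lintegral_comp hm]
    simp only [Fin.prod_univ_succ]
    rw [← ih (fun i => μ i.succ) (fun i => f i.succ) fun i => hf _]
    rw [← lintegral_prod_mul (hf 0).aemeasurable
      (Finset.measurable_prod _ fun i _ => (hf i.succ).comp (measurable_pi_apply i)).aemeasurable]
    rfl

theorem setLIntegral_pi_prod {n : ℕ} (S : Fin n → Set ℝ)
    (f : Fin n → ℝ → ℝ≥0∞) (hf : ∀ i, Measurable (f i)) :
    ∫⁻ z in {z | ∀ i, z i ∈ S i}, ∏ i, f i (z i) ∂Measure.pi (fun _ => gaussianReal 0 1)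
      = ∏ i, ∫⁻ z in S i, f i z ∂gaussianReal 0 1 := by
  have h : {z : Fin n → ℝ | ∀ i, z i ∈ S i} = Set.univ.pi S := by
    ext z
    simp
  rw [h, Measure.restrict_pi_pi, lintegral_pi_prod _ f hf]

theorem inv_le_exp_of_sq {q x : ℝ} (hq : 0 < q) (hx : x ≤ 1 / 2) (h : q ^ 2 = 1 - x) :
    q⁻¹ ≤ Real.exp (x / 2 + x ^ 2) := by
  rw [← Real.log_le_iff_le_exp (by positivity), Real.log_inv]
  have h1 := Real.one_sub_inv_le_log_of_pos (show 0 < 1 - x by linarith)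
  rw [← h, Real.log_pow, h] at h1
  have h2 : (1 - x)⁻¹ ≤ 1 + x + 2 * x ^ 2 := by
    rw [inv_le_iff_one_le_mul₀ (by linarith)]
    nlinarith [sq_nonneg x]
  push_cast at h1
  linarith

/-! ### The squared norm of a standard Gaussian vector -/

theorem lintegral_exp_sq_norm {d : ℕ} {q : ℝ} (hq : 0 < q) :
    ∫⁻ x, ENNReal.ofReal (Real.exp ((1 - q ^ 2) / 2 * ‖x‖ ^ 2))
      ∂stdGaussian (EuclideanSpace ℝ (Fin d)) = ENNReal.ofReal (q⁻¹ ^ d) := by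
  rw [← map_pi_eq_stdGaussian, lintegral_map (by fun_prop) (by fun_prop)]
  have h : ∀ z : Fin d → ℝ,
      ENNReal.ofReal (Real.exp ((1 - q ^ 2) / 2 * ‖WithLp.toLp 2 z‖ ^ 2))
        = ∏ i, ENNReal.ofReal (Real.exp (0 * z i + (1 - q ^ 2) / 2 * z i ^ 2)) := by
    intro z
    rw [← ENNReal.ofReal_prod_of_nonneg fun i _ => (Real.exp_pos _).le, ← Real.exp_sum,
      EuclideanSpace.real_norm_sq_eq, Finset.mul_sum]
    simp
  simp_rw [h]
  rw [lintegral_pi_prod _ (fun _ z => ENNReal.ofReal (Real.exp (0 * z + (1 - q ^ 2) / 2 * z ^ 2)))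
    fun i => by fun_prop]
  simp_rw [lintegral_gaussian_exp hq]
  simp only [Finset.prod_const, Finset.card_univ, Fintype.card_fin]
  rw [← ENNReal.ofReal_pow (by positivity)]
  simp

/-- During the exposure the dimension drops from `d₀` by at most `k`. Centring at `d₀` instead of
`d` costs at most `|t| * k`; the rest is the chi-square fluctuation, quadratic in `t`. -/
theorem lintegral_exp_sq_norm_sub_le {d d₀ k : ℕ} (hd : d ≤ d₀) (hdk : d₀ ≤ d + k) {t : ℝ}
    (ht : |t| ≤ 1 / 4) :
    ∫⁻ x, ENNReal.ofReal (Real.exp (t * (‖x‖ ^ 2 - d₀))) ∂stdGaussian (EuclideanSpace ℝ (Fin d))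
      ≤ ENNReal.ofReal (Real.exp (|t| * k + 4 * t ^ 2 * d₀)) := by
  obtain ⟨ht1, ht2⟩ := abs_le.1 ht
  set q := √(1 - 2 * t) with hq
  have hq2 : q ^ 2 = 1 - 2 * t := Real.sq_sqrt (by linarith)
  have hq0 : 0 < q := Real.sqrt_pos.2 (by linarith)
  have e : (1 - q ^ 2) / 2 = t := by rw [hq2]; ring
  have h := lintegral_exp_sq_norm (d := d) hq0
  rw [e] at h
  have e' : ∀ x : EuclideanSpace ℝ (Fin d), ENNReal.ofReal (Real.exp (t * (‖x‖ ^ 2 - d₀)))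
      = ENNReal.ofReal (Real.exp (t * ‖x‖ ^ 2)) * ENNReal.ofReal (Real.exp (-(t * d₀))) := by
    intro x
    rw [← ENNReal.ofReal_mul (Real.exp_pos _).le, ← Real.exp_add]
    congr 2
    ring
  simp_rw [e']
  rw [lintegral_mul_const _ (by fun_prop), h, ← ENNReal.ofReal_mul (by positivity)]
  apply ENNReal.ofReal_le_ofReal
  have h1 : q⁻¹ ^ d ≤ Real.exp ((2 * t / 2 + (2 * t) ^ 2)) ^ d := by
    gcongr
    exact inv_le_exp_of_sq hq0 (by linarith) hq2
  rw [← Real.exp_nat_mul] at h1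
  calc q⁻¹ ^ d * Real.exp (-(t * d₀))
      ≤ Real.exp (d * (2 * t / 2 + (2 * t) ^ 2)) * Real.exp (-(t * d₀)) := by gcongr
    _ = Real.exp (d * (2 * t / 2 + (2 * t) ^ 2) + -(t * d₀)) := by rw [Real.exp_add]
    _ ≤ _ := by
      rw [Real.exp_le_exp]
      have hd' : (d : ℝ) ≤ d₀ := by exact_mod_cast hd
      have hdk' : (d₀ : ℝ) ≤ d + k := by exact_mod_cast hdk
      have h2 : -t * (d₀ - d) ≤ |t| * (d₀ - d) :=
        mul_le_mul_of_nonneg_right (neg_le_abs t) (by linarith)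
      have h3 : |t| * (d₀ - d) ≤ |t| * k :=
        mul_le_mul_of_nonneg_left (by linarith) (abs_nonneg t)
      have h4 : t ^ 2 * d ≤ t ^ 2 * d₀ := mul_le_mul_of_nonneg_left hd' (sq_nonneg t)
      linarith

/-- Here `t = n * K * κ ^ 2`, so `t ^ 2 * d₀ = (n * κ) ^ 2 * K ^ 2 * m ^ 2` stays bounded when `n *
κ ≤ 1 / 2`. Fluctuations of the norm therefore cost a bounded factor per layer. The absolute value
is removed by `exp |y| ≤ exp y + exp (-y)`, and the resulting factor 2 is absorbed in `exp 1`. -/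
theorem lintegral_exp_abs_sq_norm_le {d d₀ k n : ℕ} (hd : d ≤ d₀) (hdk : d₀ ≤ d + k) (hn : n ≤ k)
    {κ m K : ℝ} (hκ : 0 < κ) (hm : κ ^ 2 * d₀ = m ^ 2) (hK : 0 ≤ K) (hkκ : k * κ ≤ 1 / 2)
    (hKκ : K * κ ≤ 1 / 2) :
    ∫⁻ x, ENNReal.ofReal (Real.exp (n * K * |(κ * ‖x‖) ^ 2 - m ^ 2|))
      ∂stdGaussian (EuclideanSpace ℝ (Fin d))
      ≤ ENNReal.ofReal (Real.exp (1 + K / 4 + K ^ 2 * m ^ 2)) := by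
  set t := n * K * κ ^ 2 with ht
  have hn' : (n : ℝ) ≤ k := by exact_mod_cast hn
  have ht0 : 0 ≤ t := by positivity
  have hnκ : n * κ ≤ 1 / 2 := le_trans (by gcongr) hkκ
  have hnκ0 : 0 ≤ n * κ := by positivity
  have ht1 : t ≤ 1 / 4 := by
    calc t = (n * κ) * (K * κ) := by rw [ht]; ring
      _ ≤ 1 / 2 * (1 / 2) := by gcongr
      _ = 1 / 4 := by norm_num
  have e : ∀ x : EuclideanSpace ℝ (Fin d),
      ENNReal.ofReal (Real.exp (n * K * |(κ * ‖x‖) ^ 2 - m ^ 2|))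
        ≤ ENNReal.ofReal (Real.exp (t * (‖x‖ ^ 2 - d₀)))
          + ENNReal.ofReal (Real.exp (-t * (‖x‖ ^ 2 - d₀))) := by
    intro x
    rw [← ENNReal.ofReal_add (Real.exp_pos _).le (Real.exp_pos _).le]
    apply ENNReal.ofReal_le_ofReal
    have : n * K * |(κ * ‖x‖) ^ 2 - m ^ 2| = |t * (‖x‖ ^ 2 - d₀)| := by
      rw [abs_mul, abs_of_nonneg ht0, ← hm, mul_pow, ← mul_sub, abs_mul,
        abs_of_nonneg (sq_nonneg κ), ht]
      ring
    rw [this, neg_mul]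
    exact Real.exp_abs_le _
  have hb : |t| * k + 4 * t ^ 2 * d₀ ≤ K / 4 + K ^ 2 * m ^ 2 := by
    rw [abs_of_nonneg ht0]
    have h1 : t * k ≤ K * (1 / 2 * (1 / 2)) := by
      calc t * k = K * ((n * κ) * (k * κ)) := by rw [ht]; ring
        _ ≤ _ := by gcongr
    have h2 : 4 * t ^ 2 * d₀ = 4 * (n * κ) ^ 2 * (K ^ 2 * m ^ 2) := by
      rw [← hm, ht]
      ring
    have h3 : (n * κ) ^ 2 ≤ (1 / 2) ^ 2 := by gcongr
    have h4 : 0 ≤ K ^ 2 * m ^ 2 := by positivity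
    rw [h2]
    nlinarith
  calc _ ≤ ∫⁻ x, (ENNReal.ofReal (Real.exp (t * (‖x‖ ^ 2 - d₀)))
          + ENNReal.ofReal (Real.exp (-t * (‖x‖ ^ 2 - d₀))))
            ∂stdGaussian (EuclideanSpace ℝ (Fin d)) := lintegral_mono e
    _ ≤ ENNReal.ofReal (Real.exp (|t| * k + 4 * t ^ 2 * d₀))
        + ENNReal.ofReal (Real.exp (|t| * k + 4 * t ^ 2 * d₀)) := by
      rw [lintegral_add_left (by fun_prop)]
      gcongr
      · exact lintegral_exp_sq_norm_sub_le hd hdk (by rwa [abs_of_nonneg ht0])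
      · have := lintegral_exp_sq_norm_sub_le hd hdk (t := -t) (by rwa [abs_neg, abs_of_nonneg ht0])
        rwa [abs_neg, neg_sq] at this
    _ ≤ _ := by
      rw [← ENNReal.ofReal_add (Real.exp_pos _).le (Real.exp_pos _).le]
      apply ENNReal.ofReal_le_ofReal
      rw [add_assoc, Real.exp_add 1]
      have h1 := Real.exp_le_exp.2 hb
      have h2 : 2 ≤ Real.exp 1 := by linarith [Real.add_one_le_exp (1 : ℝ)]
      have := Real.exp_pos (|t| * k + 4 * t ^ 2 * d₀)
      nlinarith

/-! ### One exposure step -/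

/-- Sum over pairs `i < j`. -/
def pairSum {n : ℕ} (B : Fin n → Fin n → ℝ) : ℝ := ∑ i, ∑ j, if i < j then B i j else 0

theorem pairSum_succ {n : ℕ} (B : Fin (n + 1) → Fin (n + 1) → ℝ) :
    pairSum B = ∑ j : Fin n, B 0 j.succ + pairSum fun i j => B i.succ j.succ := by
  simp [pairSum, Fin.sum_univ_succ]

theorem pairSum_sub {n : ℕ} (A B : Fin n → Fin n → ℝ) :
    pairSum (fun i j => A i j - B i j) = pairSum A - pairSum B := by
  simp only [pairSum, ← Finset.sum_sub_distrib]
  refine Finset.sum_congr rfl fun i _ => Finset.sum_congr rfl fun j _ => ?_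
  split_ifs <;> simp

theorem pairSum_mul_left {n : ℕ} (c : ℝ) (B : Fin n → Fin n → ℝ) :
    pairSum (fun i j => c * B i j) = c * pairSum B := by
  simp only [pairSum, Finset.mul_sum]
  refine Finset.sum_congr rfl fun i _ => Finset.sum_congr rfl fun j _ => ?_
  split_ifs <;> simp

theorem pairSum_const {n : ℕ} (c : ℝ) : pairSum (fun _ _ : Fin n => c) = n.choose 2 * c := by
  induction n with
  | zero => simp [pairSum]
  | succ n ih =>
    rw [pairSum_succ, ih, Nat.choose_succ_succ' n 1]
    simp
    ring

theorem pairSum_mul {n : ℕ} (z : Fin n → ℝ) :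
    pairSum (fun i j => z i * z j) = ((∑ i, z i) ^ 2 - ∑ i, z i ^ 2) / 2 := by
  induction n with
  | zero => simp [pairSum]
  | succ n ih =>
    rw [pairSum_succ, ih (fun i => z i.succ), Fin.sum_univ_succ, Fin.sum_univ_succ, ← Finset.mul_sum]
    ring

/-- Whatever the length `r`, `a` enters the exponent with the same coefficient `κ`, as the induction
requires. The price is that Φ must be bounded with slope `κ * r / q` instead of `m`. -/
theorem setLIntegral_halfline_le {Λ m K κ r q : ℝ}
    (hΦ : ∀ b : ℝ, 0 ≤ b → ∀ x : ℝ,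
      gaussCDF x ≤ Real.exp (Λ + b * x + K * |b ^ 2 - m ^ 2|))
    (hr : 0 ≤ r) (hq : 0 < q) (hκ : 0 < κ) (a s : ℝ) :
    ∫⁻ z in {z | r * z ≤ a},
        ENNReal.ofReal (Real.exp (s * z + (1 - q ^ 2) / 2 * z ^ 2)) ∂gaussianReal 0 1
      ≤ ENNReal.ofReal (q⁻¹ * Real.exp (s ^ 2 / (2 * q ^ 2) + Λ + κ * a - κ * r * s / q ^ 2
        + K * |(κ * r / q) ^ 2 - m ^ 2|)) := by
  rcases hr.eq_or_lt with rfl | hr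
  -- For `r = 0` the half-line is everything or empty. The first case needs `0 ≤ Λ + K * m ^ 2`,
  -- which follows from `hΦ` at slope 0 as `x → ∞`.
  · by_cases ha : 0 ≤ a
    · simp only [zero_mul, ha, Set.ofPred_true, Measure.restrict_univ]
      rw [lintegral_gaussian_exp hq]
      apply ENNReal.ofReal_le_ofReal
      gcongr
      have h1 : 0 ≤ Λ + K * |(κ * 0 / q) ^ 2 - m ^ 2| := by
        have h2 : (1 : ℝ) ≤ Real.exp (Λ + K * |(κ * 0 / q) ^ 2 - m ^ 2|) := by
          refine le_of_tendsto ?_ (Filter.Eventually.of_forall fun x => ?_) (f := gaussCDF)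
            (x := Filter.atTop)
          · exact (tendsto_cdf_atTop (gaussianReal 0 1)).congr fun x => cdf_eq_real _ x
          · have := hΦ (κ * 0 / q) (by simp) x
            simpa using this
        exact (Real.one_le_exp_iff).1 h2
      have h3 : 0 ≤ κ * a := by positivity
      have h4 : κ * 0 * s / q ^ 2 = 0 := by simp
      linarith
    · simp [ha]
  · have hS : {z : ℝ | r * z ≤ a} = Set.Iic (a / r) := by
      ext z
      simp only [Set.mem_ofPred_eq, Set.mem_Iic]
      rw [le_div_iff₀ hr, mul_comm]
    rw [hS, setLIntegral_Iic_gaussian_exp hq]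
    apply ENNReal.ofReal_le_ofReal
    rw [mul_assoc]
    gcongr
    have h := hΦ (κ * r / q) (by positivity) (q * (a / r) - s / q)
    calc Real.exp (s ^ 2 / (2 * q ^ 2)) * gaussCDF (q * (a / r) - s / q)
        ≤ Real.exp (s ^ 2 / (2 * q ^ 2)) * Real.exp (Λ + κ * r / q * (q * (a / r) - s / q)
          + K * |(κ * r / q) ^ 2 - m ^ 2|) := by gcongr
      _ = _ := by
        rw [← Real.exp_add]
        congr 1
        field_simp
        ring

/-- The effect of exposing one Gaussian vector `x ∈ ℝ^d` together with the components `z` of the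
remaining `n` vectors along it. -/
def LayerBound (σ κ : ℝ) (n d : ℕ) (β : ℝ) : Prop :=
  ∀ a : Fin n → ℝ,
    ∫⁻ x, ∫⁻ z in {z : Fin n → ℝ | ∀ j, ‖x‖ * z j ≤ a j},
        ENNReal.ofReal (Real.exp (-(σ * κ) * pairSum fun i j => z i * z j))
          ∂Measure.pi (fun _ => gaussianReal 0 1) ∂stdGaussian (EuclideanSpace ℝ (Fin d))
      ≤ ENNReal.ofReal (Real.exp (κ * ∑ j, a j + β))

/-- It suffices to treat a fixed length `r`, allowing an error proportional to the deviation of `κ *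
r` from `m`; that error has a bounded exponential moment. -/
theorem layerBound_of_pointwise {σ κ m K β : ℝ} {n d d₀ k : ℕ} (hd : d ≤ d₀) (hdk : d₀ ≤ d + k)
    (hn : n ≤ k) (hκ : 0 < κ) (hm : κ ^ 2 * d₀ = m ^ 2) (hK : 0 ≤ K) (hkκ : k * κ ≤ 1 / 2)
    (hKκ : K * κ ≤ 1 / 2)
    (h : ∀ r : ℝ, 0 ≤ r → ∀ a : Fin n → ℝ, ∫⁻ z in {z : Fin n → ℝ | ∀ j, r * z j ≤ a j},
        ENNReal.ofReal (Real.exp (-(σ * κ) * pairSum fun i j => z i * z j))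
          ∂Measure.pi (fun _ => gaussianReal 0 1)
        ≤ ENNReal.ofReal (Real.exp (κ * ∑ j, a j + β + n * K * |(κ * r) ^ 2 - m ^ 2|))) :
    LayerBound σ κ n d (β + (1 + K / 4 + K ^ 2 * m ^ 2)) := by
  intro a
  refine (lintegral_mono fun x => h ‖x‖ (norm_nonneg x) a).trans ?_
  simp_rw [Real.exp_add _ (n * K * _), ENNReal.ofReal_mul (Real.exp_pos _).le]
  rw [lintegral_const_mul _ (by fun_prop), ← add_assoc, Real.exp_add (κ * ∑ j, a j + β),
    ENNReal.ofReal_mul (Real.exp_pos _).le]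
  gcongr
  exact lintegral_exp_abs_sq_norm_le hd hdk hn hκ hm hK hkκ hKκ

/-- The weight contains `-κS²/2` with `S = ∑ z j`, which is concave in `S`, so its tangent at the
typical value `S = -m * n` decouples the coordinates. The diagonal part `κ/2 * ∑ z j ^ 2` is kept
and gives `q ^ 2 = 1 - κ`. The constant `2 * K + 1` covers all multiples of `|(κ * r) ^ 2 - m ^ 2|`
collected on the way. -/
theorem layerBound_red {Λ m K κ : ℝ} {n d d₀ k : ℕ} (hK : 0 ≤ K) (hm0 : 0 < m)
    (hΦ : ∀ b : ℝ, 0 ≤ b → ∀ x : ℝ,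
      gaussCDF x ≤ Real.exp (Λ + b * x + K * |b ^ 2 - m ^ 2|))
    (hd : d ≤ d₀) (hdk : d₀ ≤ d + k) (hn : n ≤ k) (hκ : 0 < κ) (hm : κ ^ 2 * d₀ = m ^ 2)
    (hkκ : k * κ ≤ 1 / 2) (hκ1 : κ ≤ 1 / 2) (hKκ : (2 * K + 1) * κ ≤ 1 / 2) :
    LayerBound 1 κ n d (n * Λ - κ * m ^ 2 * n ^ 2 / 2 + m ^ 2 * κ ^ 2 * n ^ 3 + (1 / 2 + K * m ^ 2)
      + (1 + (2 * K + 1) / 4 + (2 * K + 1) ^ 2 * m ^ 2)) := by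
  refine layerBound_of_pointwise hd hdk hn hκ hm (by positivity) hkκ hKκ fun r hr a => ?_
  set q := √(1 - κ) with hq
  have hq2 : q ^ 2 = 1 - κ := Real.sq_sqrt (by linarith)
  have hq0 : 0 < q := Real.sqrt_pos.2 (by linarith)
  set s := κ * m * n with hs
  have hn' : (n : ℝ) ≤ k := by exact_mod_cast hn
  have hnκ : n * κ ≤ 1 / 2 := le_trans (by gcongr) hkκ
  have hpt : ∀ z : Fin n → ℝ,
      ENNReal.ofReal (Real.exp (-(1 * κ) * pairSum fun i j => z i * z j))
        ≤ ENNReal.ofReal (Real.exp (κ * (m * n) ^ 2 / 2)) *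
          ∏ j, ENNReal.ofReal (Real.exp (s * z j + (1 - q ^ 2) / 2 * z j ^ 2)) := by
    intro z
    rw [← ENNReal.ofReal_prod_of_nonneg fun i _ => (Real.exp_pos _).le, ← Real.exp_sum,
      ← ENNReal.ofReal_mul (Real.exp_pos _).le, ← Real.exp_add]
    apply ENNReal.ofReal_le_ofReal
    rw [Real.exp_le_exp, pairSum_mul, Finset.sum_add_distrib, ← Finset.mul_sum, ← Finset.mul_sum,
      hq2, hs]
    nlinarith [mul_nonneg hκ.le (sq_nonneg (∑ j, z j + m * n))]
  have hint : ∀ j, ∫⁻ z in {z | r * z ≤ a j},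
        ENNReal.ofReal (Real.exp (s * z + (1 - q ^ 2) / 2 * z ^ 2)) ∂gaussianReal 0 1
      ≤ ENNReal.ofReal (Real.exp ((κ / 2 + κ ^ 2) + (s ^ 2 / (2 * q ^ 2) + Λ + κ * a j
        - κ * r * s / q ^ 2 + K * |(κ * r / q) ^ 2 - m ^ 2|))) := by
    intro j
    refine (setLIntegral_halfline_le hΦ hr hq0 hκ (a j) s).trans ?_
    apply ENNReal.ofReal_le_ofReal
    rw [Real.exp_add (κ / 2 + κ ^ 2)]
    gcongr
    exact inv_le_exp_of_sq hq0 hκ1 hq2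
  calc _ ≤ ∫⁻ z in {z : Fin n → ℝ | ∀ j, r * z j ≤ a j},
        ENNReal.ofReal (Real.exp (κ * (m * n) ^ 2 / 2)) *
          ∏ j, ENNReal.ofReal (Real.exp (s * z j + (1 - q ^ 2) / 2 * z j ^ 2))
        ∂Measure.pi (fun _ => gaussianReal 0 1) := lintegral_mono hpt
    _ = ENNReal.ofReal (Real.exp (κ * (m * n) ^ 2 / 2)) * ∏ j, ∫⁻ z in {z | r * z ≤ a j},
        ENNReal.ofReal (Real.exp (s * z + (1 - q ^ 2) / 2 * z ^ 2)) ∂gaussianReal 0 1 := by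
      rw [lintegral_const_mul _ (Finset.measurable_prod _ fun j _ => by fun_prop),
        ← setLIntegral_pi_prod (fun j => {z | r * z ≤ a j})
          (fun _ z => ENNReal.ofReal (Real.exp (s * z + (1 - q ^ 2) / 2 * z ^ 2)))
          fun j => by fun_prop]
      rfl
    _ ≤ ENNReal.ofReal (Real.exp (κ * (m * n) ^ 2 / 2)) *
        ∏ j, ENNReal.ofReal (Real.exp ((κ / 2 + κ ^ 2) + (s ^ 2 / (2 * q ^ 2) + Λ + κ * a j
        - κ * r * s / q ^ 2 + K * |(κ * r / q) ^ 2 - m ^ 2|))) := by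
      gcongr with j
      exact hint j
    _ ≤ _ := by
      rw [← ENNReal.ofReal_prod_of_nonneg fun i _ => (Real.exp_pos _).le, ← Real.exp_sum,
        ← ENNReal.ofReal_mul (Real.exp_pos _).le, ← Real.exp_add]
      apply ENNReal.ofReal_le_ofReal
      rw [Real.exp_le_exp]
      simp only [Finset.sum_add_distrib, Finset.sum_sub_distrib, Finset.sum_const,
        Finset.card_univ, Fintype.card_fin, nsmul_eq_mul, ← Finset.mul_sum]
      set y := κ * r with hy
      have hy0 : 0 ≤ y := by positivity
      set u := (q ^ 2)⁻¹ with hu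
      have hu1 : 1 ≤ u := by
        rw [hu, hq2, one_le_inv₀ (by linarith)]
        linarith
      have hu2 : u ≤ 1 + 2 * κ := by
        rw [hu, hq2, inv_le_iff_one_le_mul₀ (by linarith)]
        nlinarith
      set h := |y ^ 2 - m ^ 2| with hh
      have hh0 : 0 ≤ h := abs_nonneg _
      have e1 : s ^ 2 / (2 * q ^ 2) = s ^ 2 * u / 2 := by rw [hu]; field_simp
      have e2 : y * s / q ^ 2 = y * s * u := by rw [hu]; field_simp
      have e3 : (y / q) ^ 2 = y ^ 2 * u := by rw [hu]; field_simp
      rw [e1, e2, e3]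
      have hn0 : (0 : ℝ) ≤ n := Nat.cast_nonneg n
      have hs0 : 0 ≤ s := by positivity
      have h1 : n * (s ^ 2 * u / 2) ≤ m ^ 2 * κ ^ 2 * n ^ 3 := by
        have : n * (s ^ 2 * u / 2) ≤ n * (s ^ 2 * 2 / 2) := by gcongr; linarith
        rw [hs] at this ⊢
        linarith
      have h2 : m ^ 2 - h ≤ m * y := by
        have : |y - m| * (y + m) = h := by
          rw [hh, show y ^ 2 - m ^ 2 = (y - m) * (y + m) by ring, abs_mul,
            abs_of_nonneg (show 0 ≤ y + m by positivity)]
        have h3 := neg_le_abs (y - m)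
        have h4 := mul_nonneg (abs_nonneg (y - m)) hy0
        nlinarith
      -- This cross term is about `κ * m ^ 2 * n ^ 2`, twice the constant of the tangent line; the
      -- difference is the red gain.
      have h3 : n * (n * κ * (m ^ 2 - h)) ≤ n * (y * s * u) := by
        refine mul_le_mul_of_nonneg_left ?_ hn0
        calc n * κ * (m ^ 2 - h) ≤ n * κ * (m * y) :=
              mul_le_mul_of_nonneg_left h2 (by positivity)
          _ = y * s * 1 := by rw [hs]; ring
          _ ≤ y * s * u := by gcongr
      have h4 : n * (n * κ * h) ≤ n * (1 / 2 * h) := by gcongr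
      have h5 : |y ^ 2 * u - m ^ 2| ≤ 2 * h + 2 * κ * m ^ 2 := by
        have : y ^ 2 * u - m ^ 2 = u * (y ^ 2 - m ^ 2) + (u - 1) * m ^ 2 := by ring
        rw [this]
        refine (abs_add_le _ _).trans ?_
        rw [abs_mul, abs_mul, abs_of_nonneg (show 0 ≤ u by linarith),
          abs_of_nonneg (show 0 ≤ u - 1 by linarith), abs_of_nonneg (sq_nonneg m)]
        gcongr <;> linarith
      have h6 : n * (K * |y ^ 2 * u - m ^ 2|) ≤ n * (K * (2 * h + 2 * κ * m ^ 2)) := by gcongr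
      have h7 : (n * κ) * (2 * K * m ^ 2) ≤ 1 / 2 * (2 * K * m ^ 2) := by gcongr
      have h8 : n * κ * κ ≤ 1 / 2 * (1 / 2) := by gcongr
      have h9 : 0 ≤ n * h := by positivity
      linarith

/-- The weight `exp (κS²/2)` is now convex in `S`, so it is written as the average of `exp (√κ * g *
S)` over an auxiliary Gaussian `g`; given `g`, the coordinates decouple. The diagonal part has a
favourable sign and is dropped. The `n` coordinates return `exp (nκg²/2)`, whence `q ^ 2 = 1 - n *
κ`. The denominator uses `k` rather than `n` so that the layers can be summed. -/
theorem layerBound_blue {Λ m K κ : ℝ} {n d d₀ k : ℕ} (hK : 0 ≤ K)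
    (hΦ : ∀ b : ℝ, 0 ≤ b → ∀ x : ℝ,
      gaussCDF x ≤ Real.exp (Λ + b * x + K * |b ^ 2 - m ^ 2|))
    (hd : d ≤ d₀) (hdk : d₀ ≤ d + k) (hn : n ≤ k) (hκ : 0 < κ) (hm : κ ^ 2 * d₀ = m ^ 2)
    (hkκ : k * κ ≤ 1 / 2) (hKκ : (K + 1) * κ ≤ 1 / 2) :
    LayerBound (-1) κ n d (n * Λ + κ * m ^ 2 * n ^ 2 / (2 * (1 - k * κ)) + 1 / 2
      + (1 + (K + 1) / 4 + (K + 1) ^ 2 * m ^ 2)) := by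
  refine layerBound_of_pointwise hd hdk hn hκ hm (by positivity) hkκ hKκ fun r hr a => ?_
  have hn' : (n : ℝ) ≤ k := by exact_mod_cast hn
  have hnκk : n * κ ≤ k * κ := by gcongr
  have hnκ : n * κ ≤ 1 / 2 := hnκk.trans hkκ
  have hnκ0 : 0 ≤ n * κ := by positivity
  set q := √(1 - n * κ) with hq
  have hq2 : q ^ 2 = 1 - n * κ := Real.sq_sqrt (by linarith)
  have hq0 : 0 < q := Real.sqrt_pos.2 (by linarith)
  have hsκ : √κ ^ 2 = κ := Real.sq_sqrt hκ.le
  set h := |(κ * r) ^ 2 - m ^ 2| with hh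
  have hpt : ∀ z : Fin n → ℝ,
      ENNReal.ofReal (Real.exp (-(-1 * κ) * pairSum fun i j => z i * z j))
        ≤ ∫⁻ g, ∏ j, ENNReal.ofReal (Real.exp (√κ * g * z j + (1 - 1 ^ 2) / 2 * z j ^ 2))
          ∂gaussianReal 0 1 := by
    intro z
    have h1 := lintegral_gaussian_exp one_pos (√κ * ∑ j, z j)
    have h2 : ∀ g : ℝ,
        ∏ j, ENNReal.ofReal (Real.exp (√κ * g * z j + (1 - 1 ^ 2) / 2 * z j ^ 2))
        = ENNReal.ofReal (Real.exp ((√κ * ∑ j, z j) * g + (1 - 1 ^ 2) / 2 * g ^ 2)) := by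
      intro g
      rw [← ENNReal.ofReal_prod_of_nonneg fun i _ => (Real.exp_pos _).le, ← Real.exp_sum]
      congr 2
      rw [Finset.sum_add_distrib, ← Finset.mul_sum, ← Finset.mul_sum]
      ring
    simp_rw [h2]
    rw [h1]
    apply ENNReal.ofReal_le_ofReal
    rw [inv_one, one_mul, Real.exp_le_exp, pairSum_mul, mul_pow, hsκ]
    have : 0 ≤ ∑ i, z i ^ 2 := Finset.sum_nonneg fun i _ => sq_nonneg _
    nlinarith
  have hint : ∀ g j, ∫⁻ z in {z | r * z ≤ a j},
        ENNReal.ofReal (Real.exp (√κ * g * z + (1 - 1 ^ 2) / 2 * z ^ 2)) ∂gaussianReal 0 1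
      ≤ ENNReal.ofReal (Real.exp ((√κ * g) ^ 2 / 2 + Λ + κ * a j
        - κ * r * (√κ * g) + K * h)) := by
    intro g j
    have := setLIntegral_halfline_le hΦ hr one_pos hκ (a j) (√κ * g)
    simpa using this
  calc _ ≤ ∫⁻ z in {z : Fin n → ℝ | ∀ j, r * z j ≤ a j}, ∫⁻ g,
          ∏ j, ENNReal.ofReal (Real.exp (√κ * g * z j + (1 - 1 ^ 2) / 2 * z j ^ 2))
          ∂gaussianReal 0 1 ∂Measure.pi (fun _ => gaussianReal 0 1) := lintegral_mono hpt
    _ = ∫⁻ g, ∫⁻ z in {z : Fin n → ℝ | ∀ j, r * z j ≤ a j},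
          ∏ j, ENNReal.ofReal (Real.exp (√κ * g * z j + (1 - 1 ^ 2) / 2 * z j ^ 2))
          ∂Measure.pi (fun _ => gaussianReal 0 1) ∂gaussianReal 0 1 := by
      apply lintegral_lintegral_swap
      refine Measurable.aemeasurable (Finset.measurable_prod _ fun j _ => ?_)
      fun_prop
    _ = ∫⁻ g, ∏ j, ∫⁻ z in {z | r * z ≤ a j},
        ENNReal.ofReal (Real.exp (√κ * g * z + (1 - 1 ^ 2) / 2 * z ^ 2)) ∂gaussianReal 0 1
          ∂gaussianReal 0 1 := by
      congr 1
      ext g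
      rw [← setLIntegral_pi_prod (fun j => {z | r * z ≤ a j})
          (fun _ z => ENNReal.ofReal (Real.exp (√κ * g * z + (1 - 1 ^ 2) / 2 * z ^ 2)))
          fun j => by fun_prop]
      rfl
    _ ≤ ∫⁻ g, ∏ j, ENNReal.ofReal (Real.exp ((√κ * g) ^ 2 / 2 + Λ + κ * a j
        - κ * r * (√κ * g) + K * h)) ∂gaussianReal 0 1 := by
      refine lintegral_mono fun g => ?_
      gcongr with j
      exact hint g j
    _ = ∫⁻ g, ENNReal.ofReal (Real.exp (κ * ∑ j, a j + n * Λ + n * K * h)) *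
        ENNReal.ofReal (Real.exp (-(n * κ * r * √κ) * g + (1 - q ^ 2) / 2 * g ^ 2))
          ∂gaussianReal 0 1 := by
      congr 1
      ext g
      rw [← ENNReal.ofReal_prod_of_nonneg fun i _ => (Real.exp_pos _).le, ← Real.exp_sum,
        ← ENNReal.ofReal_mul (Real.exp_pos _).le, ← Real.exp_add]
      congr 2
      simp only [Finset.sum_add_distrib, Finset.sum_sub_distrib, Finset.sum_const,
        Finset.card_univ, Fintype.card_fin, nsmul_eq_mul, ← Finset.mul_sum]
      rw [hq2, mul_pow, hsκ]
      ring
    _ ≤ _ := by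
      rw [lintegral_const_mul _ (by fun_prop), lintegral_gaussian_exp hq0,
        ← ENNReal.ofReal_mul (Real.exp_pos _).le]
      apply ENNReal.ofReal_le_ofReal
      have h1 := inv_le_exp_of_sq hq0 hnκ hq2
      calc _ ≤ Real.exp (κ * ∑ j, a j + n * Λ + n * K * h) *
            (Real.exp (n * κ / 2 + (n * κ) ^ 2) *
              Real.exp ((-(n * κ * r * √κ)) ^ 2 / (2 * q ^ 2))) := by gcongr
        _ = Real.exp (κ * ∑ j, a j + n * Λ + n * K * h + (n * κ / 2 + (n * κ) ^ 2
              + (-(n * κ * r * √κ)) ^ 2 / (2 * q ^ 2))) := by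
          rw [← Real.exp_add, ← Real.exp_add]
        _ ≤ _ := by
          rw [Real.exp_le_exp, hq2, neg_sq, mul_pow (n * κ * r), hsκ]
          have hh0 : 0 ≤ h := abs_nonneg _
          have h2 : (κ * r) ^ 2 ≤ m ^ 2 + h := by
            have := le_abs_self ((κ * r) ^ 2 - m ^ 2)
            linarith
          have h3 : (n * κ * r) ^ 2 * κ / (2 * (1 - n * κ))
              ≤ n ^ 2 * κ * (m ^ 2 + h) / (2 * (1 - n * κ)) := by
            rw [show (n * κ * r) ^ 2 * κ = n ^ 2 * κ * (κ * r) ^ 2 by ring]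
            have : 0 < 1 - n * κ := by linarith
            gcongr
          have h4 : n ^ 2 * κ * m ^ 2 / (2 * (1 - n * κ))
              ≤ κ * m ^ 2 * n ^ 2 / (2 * (1 - k * κ)) := by
            rw [show n ^ 2 * κ * m ^ 2 = κ * m ^ 2 * n ^ 2 by ring]
            have : 0 < 1 - k * κ := by linarith
            gcongr
          have h5 : n ^ 2 * κ * h / (2 * (1 - n * κ)) ≤ n * h := by
            rw [div_le_iff₀ (by linarith)]
            have : 0 ≤ n * h := by positivity
            nlinarith
          have h6 : (n * κ) ^ 2 ≤ (1 / 2) ^ 2 := by gcongr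
          rw [mul_add, add_div] at h3
          linarith

/-! ### Exposing Gaussian vectors one at a time -/

/-- The vectors `x` satisfy `σ ⟨x i, x j⟩ ≤ A i j` for all `i < j`. -/
def pairEvent (σ : ℝ) {n : ℕ} (d : ℕ) (A : Fin n → Fin n → ℝ) :
    Set (Fin n → EuclideanSpace ℝ (Fin d)) :=
  {x | ∀ i j, i < j → σ * inner ℝ (x i) (x j) ≤ A i j}

theorem measurableSet_pairEvent (σ : ℝ) {n : ℕ} (d : ℕ) (A : Fin n → Fin n → ℝ) :
    MeasurableSet (pairEvent σ d A) := by
  unfold pairEvent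
  measurability

/-- Prepend a coordinate to a vector. -/
noncomputable def consVec {d : ℕ} (t : ℝ) (w : EuclideanSpace ℝ (Fin d)) :
    EuclideanSpace ℝ (Fin (d + 1)) :=
  WithLp.toLp 2 (Fin.cons t w.ofLp : Fin (d + 1) → ℝ)

theorem inner_consVec {d : ℕ} (t t' : ℝ) (w w' : EuclideanSpace ℝ (Fin d)) :
    inner ℝ (consVec t w) (consVec t' w') = t * t' + inner ℝ w w' := by
  simp [consVec, PiLp.inner_apply, Fin.sum_univ_succ, mul_comm]

theorem measurePreserving_consVec (d : ℕ) :
    MeasurePreserving (fun p : ℝ × EuclideanSpace ℝ (Fin d) => consVec p.1 p.2)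
      ((gaussianReal 0 1).prod (stdGaussian (EuclideanSpace ℝ (Fin d))))
      (stdGaussian (EuclideanSpace ℝ (Fin (d + 1)))) := by
  have h1 : ∀ d : ℕ, MeasurePreserving (MeasurableEquiv.toLp 2 (Fin d → ℝ))
      (Measure.pi fun _ => gaussianReal 0 1) (stdGaussian (EuclideanSpace ℝ (Fin d))) :=
    fun d => ⟨by fun_prop, map_pi_eq_stdGaussian⟩
  have h2 := (measurePreserving_piFinSuccAbove
    (fun _ : Fin (d + 1) => gaussianReal 0 1) 0).symm
  convert ((h1 (d + 1)).comp h2).comp ((MeasurePreserving.id _).prod (h1 d).symm) using 1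
  ext p
  simp [consVec, MeasurableEquiv.piFinSuccAbove]

theorem measurePreserving_pi_consVec (n d : ℕ) :
    MeasurePreserving
      (fun (p : (Fin n → ℝ) × (Fin n → EuclideanSpace ℝ (Fin d))) i => consVec (p.1 i) (p.2 i))
      ((Measure.pi fun _ => gaussianReal 0 1).prod
        (Measure.pi fun _ => stdGaussian (EuclideanSpace ℝ (Fin d))))
      (Measure.pi fun _ => stdGaussian (EuclideanSpace ℝ (Fin (d + 1)))) := by
  have h1 := (measurePreserving_arrowProdEquivProdArrow ℝ (EuclideanSpace ℝ (Fin d)) (Fin n)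
    (fun _ => gaussianReal 0 1) (fun _ => stdGaussian (EuclideanSpace ℝ (Fin d)))).symm
  have h2 := measurePreserving_pi (fun _ : Fin n => (gaussianReal 0 1).prod
    (stdGaussian (EuclideanSpace ℝ (Fin d)))) _ (fun _ => measurePreserving_consVec d)
  exact h2.comp h1

/-- A reflection exchanges two vectors of equal norm. The sign `σ` in the target makes the
constraint on the coordinates read `‖x‖ * z j ≤ a j` in both colours. -/
theorem exists_isometry_to_axis {σ : ℝ} (hσ : |σ| = 1) {d : ℕ}
    (x : EuclideanSpace ℝ (Fin (d + 1))) :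
    ∃ U : EuclideanSpace ℝ (Fin (d + 1)) ≃ₗᵢ[ℝ] EuclideanSpace ℝ (Fin (d + 1)),
      U x = consVec (σ * ‖x‖) 0 := by
  refine ⟨_, Submodule.reflection_sub (v := x) (w := consVec (σ * ‖x‖) 0) ?_⟩
  rw [← sq_eq_sq₀ (norm_nonneg _) (norm_nonneg _), ← real_inner_self_eq_norm_sq (consVec _ _),
    inner_consVec, inner_zero_left, add_zero, ← sq, mul_pow, ← sq_abs σ, hσ]
  ring

theorem pairEvent_succ_le {σ : ℝ} (hσ : |σ| = 1) {n d : ℕ} (A : Fin (n + 1) → Fin (n + 1) → ℝ) :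
    (Measure.pi fun _ => stdGaussian (EuclideanSpace ℝ (Fin (d + 1)))) (pairEvent σ (d + 1) A)
      ≤ ∫⁻ x, ∫⁻ z in {z : Fin n → ℝ | ∀ j, ‖x‖ * z j ≤ A 0 j.succ},
          (Measure.pi fun _ => stdGaussian (EuclideanSpace ℝ (Fin d)))
            (pairEvent σ d fun i j => A i.succ j.succ - σ * (z i * z j))
          ∂Measure.pi (fun _ => gaussianReal 0 1)
        ∂stdGaussian (EuclideanSpace ℝ (Fin (d + 1))) := by
  have hsq : σ * σ = 1 := by rw [← sq, ← sq_abs, hσ, one_pow]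
  have hsf : SigmaFinite (stdGaussian (EuclideanSpace ℝ (Fin (d + 1)))) := inferInstance
  have h1 := (measurePreserving_piFinSuccAbove
    (fun _ : Fin (n + 1) => stdGaussian (EuclideanSpace ℝ (Fin (d + 1)))) 0).symm
  rw [← h1.measure_preimage (measurableSet_pairEvent _ _ _).nullMeasurableSet,
    Measure.prod_apply (h1.measurable (measurableSet_pairEvent _ _ _))]
  refine lintegral_mono fun x => ?_
  let T : EuclideanSpace ℝ (Fin (d + 1)) → Set (Fin n → EuclideanSpace ℝ (Fin (d + 1))) :=
    fun x => {y | ∀ j, σ * inner ℝ x (y j) ≤ A 0 j.succ} ∩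
      pairEvent σ (d + 1) fun i j => A i.succ j.succ
  have hT : ∀ x, MeasurableSet (T x) := by
    intro x
    refine MeasurableSet.inter ?_ (measurableSet_pairEvent _ _ _)
    measurability
  have e1 : Prod.mk x ⁻¹' ((MeasurableEquiv.piFinSuccAbove
      (fun _ : Fin (n + 1) => EuclideanSpace ℝ (Fin (d + 1))) 0).symm ⁻¹' pairEvent σ (d + 1) A)
      = T x := by
    ext y
    simp only [Set.mem_preimage, pairEvent, Set.mem_ofPred_eq, T, Set.mem_inter_iff]
    rw [Fin.forall_fin_succ]
    simp only [Fin.forall_fin_succ (n := n)]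
    simp [MeasurableEquiv.piFinSuccAbove]
  obtain ⟨U, hU⟩ := exists_isometry_to_axis hσ x
  have h2 := measurePreserving_pi (fun _ : Fin n => stdGaussian (EuclideanSpace ℝ (Fin (d + 1)))) _
    (fun _ => (⟨by fun_prop, stdGaussian_map U⟩ : MeasurePreserving U _ _))
  have e2 : (fun (y : Fin n → EuclideanSpace ℝ (Fin (d + 1))) i => U (y i)) ⁻¹' T (U x) = T x := by
    ext y
    simp [T, pairEvent]
  rw [e1, ← e2, h2.measure_preimage (hT _).nullMeasurableSet,
    ← (measurePreserving_pi_consVec n d).measure_preimage (hT _).nullMeasurableSet,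
    Measure.prod_apply ((measurePreserving_pi_consVec n d).measurable (hT _)),
    ← lintegral_indicator (by measurability)]
  refine lintegral_mono fun z => ?_
  by_cases hz : z ∈ {z : Fin n → ℝ | ∀ j, ‖x‖ * z j ≤ A 0 j.succ}
  · rw [Set.indicator_of_mem hz]
    refine measure_mono fun w hw => ?_
    have hw := hw.2
    simp only [pairEvent, Set.mem_ofPred_eq, inner_consVec] at hw ⊢
    intro i j hij
    have := hw i j hij
    linarith
  · rw [Set.indicator_of_notMem hz]
    refine le_of_eq (measure_mono_null (t := ∅) (fun w hw => ?_) measure_empty)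
    refine hz fun j => ?_
    have := hw.1 j
    rw [hU, inner_consVec, inner_zero_left, add_zero] at this
    have e : σ * (σ * ‖x‖ * z j) = ‖x‖ * z j := by
      rw [← mul_assoc, ← mul_assoc, hsq, one_mul]
    linarith

/-- Shifting `A` by `-σ * (z i * z j)` multiplies the inductive bound by exactly the weight in
`LayerBound`. The condition `d₀ + n ≤ d + k` says that one dimension is lost per exposed vector. -/
theorem measure_pairEvent_le {σ κ : ℝ} (hσ : |σ| = 1) {d₀ k : ℕ} (hk : k < d₀) (β : ℕ → ℝ)
    (hβ : ∀ n d : ℕ, n < k → d ≤ d₀ → d₀ ≤ d + k → LayerBound σ κ n d (β n)) (n : ℕ) :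
    ∀ d : ℕ, d ≤ d₀ → n ≤ k → d₀ + n ≤ d + k → ∀ A : Fin n → Fin n → ℝ,
      (Measure.pi fun _ => stdGaussian (EuclideanSpace ℝ (Fin d))) (pairEvent σ d A)
        ≤ ENNReal.ofReal (Real.exp (κ * pairSum A + ∑ i ∈ Finset.range n, β i)) := by
  induction n with
  | zero =>
    intro d _ _ _ A
    simpa [pairSum] using prob_le_one
  | succ n ih =>
    intro d hd hn hdk A
    -- The dimension is still positive because `k < d₀`.
    obtain ⟨d, rfl⟩ : ∃ e, d = e + 1 := ⟨d - 1, by omega⟩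
    refine (pairEvent_succ_le hσ A).trans ?_
    have h1 : ∀ z : Fin n → ℝ, (Measure.pi fun _ => stdGaussian (EuclideanSpace ℝ (Fin d)))
          (pairEvent σ d fun i j => A i.succ j.succ - σ * (z i * z j))
        ≤ ENNReal.ofReal (Real.exp (κ * (pairSum fun i j => A i.succ j.succ)
            + ∑ i ∈ Finset.range n, β i)) *
          ENNReal.ofReal (Real.exp (-(σ * κ) * pairSum fun i j => z i * z j)) := by
      intro z
      refine (ih d (by omega) (by omega) (by omega) _).trans (le_of_eq ?_)
      rw [← ENNReal.ofReal_mul (Real.exp_pos _).le, ← Real.exp_add, pairSum_sub, pairSum_mul_left]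
      congr 2
      ring
    refine (lintegral_mono fun x => lintegral_mono h1).trans ?_
    have hm : Measurable fun z : Fin n → ℝ =>
        ENNReal.ofReal (Real.exp (-(σ * κ) * pairSum fun i j => z i * z j)) := by
      simp only [pairSum_mul]
      fun_prop
    simp_rw [lintegral_const_mul _ hm]
    rw [lintegral_const_mul']
    · refine (mul_le_mul_right (hβ n (d + 1) (by omega) hd (by omega)
        fun j => A 0 j.succ) _).trans (le_of_eq ?_)
      rw [← ENNReal.ofReal_mul (Real.exp_pos _).le, ← Real.exp_add, pairSum_succ,
        Finset.sum_range_succ]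
      congr 2
      ring
    · exact ENNReal.ofReal_ne_top

/-! ### Red and blue cliques of the geometric graph -/

open scoped MatrixOrder in
theorem gaussVectors_eq_map (n d : ℕ) :
    gaussVectors n d = (Measure.pi fun _ => stdGaussian (EuclideanSpace ℝ (Fin d))).map
      fun x i => (√d)⁻¹ • x i := by
  have h : multivariateGaussian (0 : EuclideanSpace ℝ (Fin d))
      ((1 / (d : ℝ)) • (1 : Matrix (Fin d) (Fin d) ℝ))
      = (stdGaussian (EuclideanSpace ℝ (Fin d))).map fun x => (√d)⁻¹ • x := by
    have hs : CFC.sqrt ((1 / (d : ℝ)) • (1 : Matrix (Fin d) (Fin d) ℝ)) = (√d)⁻¹ • (1 : Matrix (Fin d) (Fin d) ℝ) := by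
      apply CFC.sqrt_unique
      · rw [smul_mul_smul_comm, one_mul, ← mul_inv, Real.mul_self_sqrt (Nat.cast_nonneg d), one_div]
      · exact (Matrix.PosSemidef.one.smul (by positivity)).nonneg
    rw [multivariateGaussian, hs]
    congr 1
    ext x
    simp
  have := measurePreserving_pi (fun _ : Fin n => stdGaussian (EuclideanSpace ℝ (Fin d))) _
    (fun _ => (⟨by fun_prop, h.symm⟩ : MeasurePreserving (fun x => (√d)⁻¹ • x) _ _))
  exact this.map_eq.symm

theorem gaussVectors_real_le {n d : ℕ} (hd : 0 < d) {σ c : ℝ}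
    (S : Set (Fin n → EuclideanSpace ℝ (Fin d)))
    (hS : ∀ x ∈ S, ∀ i j, i < j → σ * inner ℝ (x i) (x j) ≤ c / √d) {b : ℝ} (hb : 0 ≤ b)
    (h : (Measure.pi fun _ => stdGaussian (EuclideanSpace ℝ (Fin d)))
      (pairEvent σ d fun _ _ : Fin n => c * √d) ≤ ENNReal.ofReal b) :
    (gaussVectors n d).real S ≤ b := by
  have hd' : 0 < √(d : ℝ) := Real.sqrt_pos.2 (by exact_mod_cast hd)
  rw [measureReal_def]
  refine ENNReal.toReal_le_of_le_ofReal hb (le_trans ?_ h)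
  have hS' : S ⊆ pairEvent σ d fun _ _ : Fin n => c / √d := hS
  refine (measure_mono hS').trans (le_of_eq ?_)
  rw [gaussVectors_eq_map, Measure.map_apply (by fun_prop) (measurableSet_pairEvent _ _ _)]
  congr 1
  ext x
  simp only [pairEvent, Set.mem_preimage, Set.mem_ofPred_eq, real_inner_smul_left,
    real_inner_smul_right]
  refine forall_congr' fun i => forall_congr' fun j => imp_congr_right fun _ => ?_
  have e : c / √d = (c * √d) * ((√d)⁻¹ * (√d)⁻¹) := by field_simp
  rw [e, show σ * ((√d)⁻¹ * ((√d)⁻¹ * inner ℝ (x i) (x j)))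
    = (σ * inner ℝ (x i) (x j)) * ((√d)⁻¹ * (√d)⁻¹) by ring]
  exact mul_le_mul_iff_left₀ (by positivity)

theorem probRed_le {n d : ℕ} {p b : ℝ} (hd : 0 < d) (hb : 0 ≤ b)
    (h : (Measure.pi fun _ => stdGaussian (EuclideanSpace ℝ (Fin d)))
      (pairEvent 1 d fun _ _ : Fin n => -gaussThreshold p * √d) ≤ ENNReal.ofReal b) :
    probRed n d p ≤ b := by
  refine gaussVectors_real_le hd _ (fun x hx i j hij => ?_) hb h
  have := hx (Set.mem_univ i) (Set.mem_univ j) hij.ne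
  simp only [geomGraph, not_and, not_le] at this
  rw [one_mul]
  exact (this hij.ne).le

theorem probBlue_le {n d : ℕ} {p b : ℝ} (hd : 0 < d) (hb : 0 ≤ b)
    (h : (Measure.pi fun _ => stdGaussian (EuclideanSpace ℝ (Fin d)))
      (pairEvent (-1) d fun _ _ : Fin n => gaussThreshold p * √d) ≤ ENNReal.ofReal b) :
    probBlue n d p ≤ b := by
  refine gaussVectors_real_le hd _ (fun x hx i j hij => ?_) hb h
  have := hx (Set.mem_univ i) (Set.mem_univ j) hij.ne
  simp only [geomGraph] at this
  have h2 := this.2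
  rw [neg_div] at h2
  linarith

open Filter Topology

theorem sum_range_layers (n : ℕ) (a b c e : ℝ) :
    ∑ i ∈ Finset.range n, (i * a + b * i ^ 2 + c * i ^ 3 + e)
      = n.choose 2 * (a + b * (2 * n - 1) / 3 + c * n.choose 2) + n * e := by
  rw [Nat.cast_choose_two]
  induction n with
  | zero => simp
  | succ n ih =>
    rw [Finset.sum_range_succ, ih]
    push_cast
    ring

/-- The choice `κ = m / √d` turns the rescaled threshold into `m * -gaussThreshold p` per pair. A
loss `B` in each of `n` layers amounts to `2 * B / (n - 1)` per pair. -/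
theorem probRed_le_exp (θ : ℝ) : ∃ B κ₀ : ℝ, 0 ≤ B ∧ 0 < κ₀ ∧ ∀ (n d : ℕ) (p : ℝ), 2 ≤ n → n < d →
    hazard θ * (√d)⁻¹ ≤ κ₀ → hazard θ * (n / √d) ≤ 1 / 2 →
    probRed n d p ≤ Real.exp (n.choose 2 * (Real.log (gaussCDF θ)
      + hazard θ * (-gaussThreshold p - θ) - hazard θ ^ 3 * (2 * (n / √d) - (√d)⁻¹) / 6
      + hazard θ ^ 4 * (n / √d) ^ 2 / 2 + 2 * B * ((n : ℝ) - 1)⁻¹)) := by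
  obtain ⟨K, hK, hΦ⟩ := exists_gaussCDF_le_affine θ
  set m := hazard θ with hm
  have hm0 : 0 < m := hazard_pos θ
  set B := (1 / 2 + K * m ^ 2) + (1 + (2 * K + 1) / 4 + (2 * K + 1) ^ 2 * m ^ 2) with hB
  refine ⟨B, (2 * (2 * K + 1))⁻¹, by positivity, by positivity, fun n d p hn hnd hκ₀ hnκ => ?_⟩
  have hd : 0 < √(d : ℝ) := Real.sqrt_pos.2 (by exact_mod_cast (show 0 < d by omega))
  set κ := m * (√d)⁻¹ with hκdef
  have hκ : 0 < κ := by positivity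
  have hκd : κ * √d = m := by rw [hκdef]; field_simp
  have hκ2 : κ ^ 2 * d = m ^ 2 := by
    rw [← Real.sq_sqrt (Nat.cast_nonneg (α := ℝ) d), ← mul_pow κ, hκd]
  have hKκ : (2 * K + 1) * κ ≤ 1 / 2 := by
    calc (2 * K + 1) * κ ≤ (2 * K + 1) * (2 * (2 * K + 1))⁻¹ := by gcongr
      _ = 1 / 2 := by field_simp
  have hκ1 : κ ≤ 1 / 2 := by nlinarith
  have hx : m * (n / √d) = n * κ := by rw [hκdef]; field_simp
  rw [hx] at hnκ
  refine probRed_le (by omega) (Real.exp_pos _).le ?_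
  refine (measure_pairEvent_le (κ := κ) (by simp) hnd _ (fun i d' hi hd' hdd =>
    layerBound_red hK.le hm0 hΦ hd' hdd hi.le hκ hκ2 hnκ hκ1 hKκ) n d le_rfl le_rfl le_rfl _).trans ?_
  apply ENNReal.ofReal_le_ofReal
  rw [Real.exp_le_exp, pairSum_const]
  have hn1 : (0 : ℝ) < n - 1 := by
    have : (2 : ℝ) ≤ n := by exact_mod_cast hn
    linarith
  have hsum := sum_range_layers n (Real.log (gaussCDF θ) - m * θ) (-(κ * m ^ 2 / 2))
    (m ^ 2 * κ ^ 2) B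
  have hsum' : ∑ i ∈ Finset.range n, (i * (Real.log (gaussCDF θ) - m * θ) - κ * m ^ 2 * i ^ 2 / 2
      + m ^ 2 * κ ^ 2 * i ^ 3 + (1 / 2 + K * m ^ 2)
      + (1 + (2 * K + 1) / 4 + (2 * K + 1) ^ 2 * m ^ 2))
      = n.choose 2 * (Real.log (gaussCDF θ) - m * θ + -(κ * m ^ 2 / 2) * (2 * n - 1) / 3
        + m ^ 2 * κ ^ 2 * n.choose 2) + n * B := by
    rw [← hsum]
    refine Finset.sum_congr rfl fun i _ => ?_
    rw [hB]
    ring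
  rw [hsum']
  have e1 : κ * (n.choose 2 * (-gaussThreshold p * √d)) = n.choose 2 * (m * -gaussThreshold p) := by
    rw [← hκd]
    ring
  have e2 : m ^ 3 * (2 * (n / √d) - (√d)⁻¹) / 6 = κ * m ^ 2 / 2 * (2 * n - 1) / 3 := by
    rw [hκdef]
    field_simp
    ring
  have e3 : m ^ 4 * (n / √d) ^ 2 / 2 = m ^ 2 * κ ^ 2 * (n ^ 2 / 2) := by
    rw [hκdef]
    field_simp
  have e4 : n.choose 2 * (2 * B * ((n : ℝ) - 1)⁻¹) = n * B := by
    rw [Nat.cast_choose_two]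
    field_simp
  have h5 : (n.choose 2 : ℝ) ≤ n ^ 2 / 2 := by
    rw [Nat.cast_choose_two]
    nlinarith
  have h6 : n.choose 2 * (m ^ 2 * κ ^ 2 * (n.choose 2 : ℝ))
      ≤ n.choose 2 * (m ^ 2 * κ ^ 2 * (n ^ 2 / 2)) := by gcongr
  rw [e1, e2, e3, mul_add _ _ (2 * B * _), e4]
  linarith

theorem probBlue_le_exp (θ : ℝ) : ∃ B κ₀ : ℝ, 0 ≤ B ∧ 0 < κ₀ ∧ ∀ (n d : ℕ) (p : ℝ), 2 ≤ n → n < d →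
    hazard θ * (√d)⁻¹ ≤ κ₀ → hazard θ * (n / √d) ≤ 1 / 2 →
    probBlue n d p ≤ Real.exp (n.choose 2 * (Real.log (gaussCDF θ)
      + hazard θ * (gaussThreshold p - θ)
      + hazard θ ^ 3 * (2 * (n / √d) - (√d)⁻¹) / (6 * (1 - hazard θ * (n / √d)))
      + 2 * B * ((n : ℝ) - 1)⁻¹)) := by
  obtain ⟨K, hK, hΦ⟩ := exists_gaussCDF_le_affine θ
  set m := hazard θ with hm
  have hm0 : 0 < m := hazard_pos θ
  set B := 1 / 2 + (1 + (K + 1) / 4 + (K + 1) ^ 2 * m ^ 2) with hB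
  refine ⟨B, (2 * (K + 1))⁻¹, by positivity, by positivity, fun n d p hn hnd hκ₀ hnκ => ?_⟩
  have hd : 0 < √(d : ℝ) := Real.sqrt_pos.2 (by exact_mod_cast (show 0 < d by omega))
  set κ := m * (√d)⁻¹ with hκdef
  have hκ : 0 < κ := by positivity
  have hκd : κ * √d = m := by rw [hκdef]; field_simp
  have hκ2 : κ ^ 2 * d = m ^ 2 := by
    rw [← Real.sq_sqrt (Nat.cast_nonneg (α := ℝ) d), ← mul_pow κ, hκd]
  have hKκ : (K + 1) * κ ≤ 1 / 2 := by
    calc (K + 1) * κ ≤ (K + 1) * (2 * (K + 1))⁻¹ := by gcongr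
      _ = 1 / 2 := by field_simp
  have hx : m * (n / √d) = n * κ := by rw [hκdef]; field_simp
  rw [hx] at hnκ ⊢
  refine probBlue_le (by omega) (Real.exp_pos _).le ?_
  refine (measure_pairEvent_le (κ := κ) (by simp) hnd _ (fun i d' hi hd' hdd =>
    layerBound_blue hK.le hΦ hd' hdd hi.le hκ hκ2 hnκ hKκ) n d le_rfl le_rfl le_rfl _).trans ?_
  apply ENNReal.ofReal_le_ofReal
  rw [Real.exp_le_exp, pairSum_const]
  have hn1 : (0 : ℝ) < n - 1 := by
    have : (2 : ℝ) ≤ n := by exact_mod_cast hn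
    linarith
  have hsum := sum_range_layers n (Real.log (gaussCDF θ) - m * θ)
    (κ * m ^ 2 / (2 * (1 - n * κ))) 0 B
  have hsum' : ∑ i ∈ Finset.range n, (i * (Real.log (gaussCDF θ) - m * θ)
      + κ * m ^ 2 * i ^ 2 / (2 * (1 - n * κ)) + 1 / 2
      + (1 + (K + 1) / 4 + (K + 1) ^ 2 * m ^ 2))
      = n.choose 2 * (Real.log (gaussCDF θ) - m * θ
        + κ * m ^ 2 / (2 * (1 - n * κ)) * (2 * n - 1) / 3 + 0 * n.choose 2) + n * B := by
    rw [← hsum]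
    refine Finset.sum_congr rfl fun i _ => ?_
    rw [hB]
    ring
  rw [hsum']
  have e1 : κ * (n.choose 2 * (gaussThreshold p * √d)) = n.choose 2 * (m * gaussThreshold p) := by
    rw [← hκd]
    ring
  have e2 : m ^ 3 * (2 * (n / √d) - (√d)⁻¹) / (6 * (1 - n * κ))
      = κ * m ^ 2 / (2 * (1 - n * κ)) * (2 * n - 1) / 3 := by
    have : m ^ 3 * (2 * (n / √d) - (√d)⁻¹) = κ * m ^ 2 * (2 * n - 1) := by
      rw [hκdef]
      field_simp
    rw [this]
    have : 1 - n * κ ≠ 0 := by linarith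
    field_simp
    ring
  have e4 : n.choose 2 * (2 * B * ((n : ℝ) - 1)⁻¹) = n * B := by
    rw [Nat.cast_choose_two]
    field_simp
  rw [e1, e2, mul_add _ _ (2 * B * _), e4]
  linarith

/-! ### The gain at the Erdős probability -/

/-- The function `G x = x² log x - (1 - x)² log (1 - x)` vanishes at 0 and 1/2, and `G'' = 2 (log x
- log (1 - x))` is negative between them, so strict concavity makes `G` positive there. -/
theorem sq_mul_log_lt {q : ℝ} (h0 : 0 < q) (h1 : q < 1 / 2) :
    q ^ 2 * -Real.log q < (1 - q) ^ 2 * -Real.log (1 - q) := by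
  let G : ℝ → ℝ := fun x => x * (x * Real.log x) - (1 - x) * ((1 - x) * Real.log (1 - x))
  let G' : ℝ → ℝ := fun x => 2 * (x * Real.log x) + 2 * ((1 - x) * Real.log (1 - x)) + 1
  have hG : ∀ x ∈ Set.Ioo (0 : ℝ) 1, HasDerivAt G (G' x) x := by
    intro x hx
    have hx0 : x ≠ 0 := hx.1.ne'
    have hx1 : 1 - x ≠ 0 := by have := hx.2; linarith
    have hid := hasDerivAt_id x
    have hsub := (hasDerivAt_id x).const_sub 1
    have h := (hid.mul (hid.mul (hid.log hx0))).sub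
      (hsub.mul (hsub.mul (hsub.log hx1)))
    refine h.congr_deriv ?_
    simp only [G', id, Pi.mul_apply]
    field_simp
    ring
  have hG2 : ∀ x ∈ Set.Ioo (0 : ℝ) 1, HasDerivAt G' (2 * (Real.log x - Real.log (1 - x))) x := by
    intro x hx
    have hx0 : x ≠ 0 := hx.1.ne'
    have hx1 : 1 - x ≠ 0 := by have := hx.2; linarith
    have hid := hasDerivAt_id x
    have hsub := (hasDerivAt_id x).const_sub 1
    have h := (((hid.mul (hid.log hx0)).const_mul 2).add
      ((hsub.mul (hsub.log hx1)).const_mul 2)).add_const 1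
    refine h.congr_deriv ?_
    simp only [id]
    field_simp
    ring
  have hc : ContinuousOn G (Set.Icc 0 (1 / 2)) := by
    have := Real.continuous_mul_log
    have h2 : Continuous fun x : ℝ => (1 - x) * Real.log (1 - x) :=
      this.comp (by fun_prop : Continuous fun x : ℝ => 1 - x)
    exact Continuous.continuousOn (by fun_prop)
  have hconv : StrictConcaveOn ℝ (Set.Icc (0 : ℝ) (1 / 2)) G := by
    refine strictConcaveOn_of_deriv2_neg (convex_Icc _ _) hc fun x hx => ?_
    rw [interior_Icc] at hx
    have hx' : x ∈ Set.Ioo (0 : ℝ) 1 := ⟨hx.1, by have := hx.2; linarith⟩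
    have e : deriv G =ᶠ[𝓝 x] G' := by
      filter_upwards [isOpen_Ioo.mem_nhds hx'] with y hy using (hG y hy).deriv
    rw [Function.iterate_succ, Function.comp_apply, Function.iterate_one, e.deriv_eq,
      (hG2 x hx').deriv]
    have := Real.log_lt_log hx.1 (show x < 1 - x by have := hx.2; linarith)
    linarith
  have h2q0 : 0 < 1 - 2 * q := by linarith
  obtain ⟨-, hconv⟩ := hconv
  have h := hconv (show (0 : ℝ) ∈ Set.Icc (0 : ℝ) (1 / 2) by norm_num)
    (show (1 / 2 : ℝ) ∈ Set.Icc (0 : ℝ) (1 / 2) by norm_num) (by norm_num)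
    h2q0 (show 0 < 2 * q by linarith) (by ring)
  have e0 : G 0 = 0 := by simp [G]
  have e1 : G (1 / 2) = 0 := by
    simp only [G]
    norm_num
  rw [e0, e1] at h
  simp only [smul_eq_mul, mul_zero, zero_add, G] at h
  rw [show 2 * q * (1 / 2) = q by ring] at h
  nlinarith

theorem erdosProb_sq_lt {C q : ℝ} (h : IsErdosProb C q) : C * q ^ 2 < (1 - q) ^ 2 := by
  have h1 := sq_mul_log_lt h.1 h.2.1
  have hl : Real.log (1 - q) < 0 := Real.log_neg (by have := h.2.1; linarith) (by linarith [h.1])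
  have h2 : Real.log q = C * Real.log (1 - q) := by
    have := (isErdosProb_iff h.1 h.2.1).1 h
    linarith
  rw [h2] at h1
  by_contra hc
  nlinarith

theorem hazard_mul (θ : ℝ) : hazard (-θ) * gaussCDF (-θ) = hazard θ * gaussCDF θ := by
  unfold hazard
  rw [div_mul_cancel₀ _ (gaussCDF_pos _).ne', div_mul_cancel₀ _ (gaussCDF_pos _).ne']
  simp [gaussianPDFReal]

theorem gaussThreshold_gaussCDF {c : ℝ} (hc : 0 < c) :
    0 < gaussCDF (-c) ∧ gaussCDF (-c) < 1 / 2 ∧ gaussThreshold (gaussCDF (-c)) = c := by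
  have h1 : gaussCDF (-c) < 1 / 2 := by
    rw [← gaussianReal_Iic_zero]
    exact gaussianReal_Iic_strictMono (by linarith)
  refine ⟨gaussCDF_pos _, h1, ?_⟩
  exact (existsUnique_isGaussThreshold (gaussCDF_pos (-c)) h1).unique
    (gaussThreshold_spec (gaussCDF_pos _) h1) ⟨hc, rfl⟩

/-! ### The limit `ℓ → ∞` -/

/-- `ℓ → ∞` along triples `(ℓ, d, k)` with `d ≈ D² ℓ²` and `k ≈ C ℓ`. -/
def ramseyFilter (C D : ℝ) : Filter (ℕ × ℕ × ℕ) :=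
  comap Prod.fst atTop ⊓ 𝓟 {t | |(t.2.1 : ℝ) - D ^ 2 * (t.1 : ℝ) ^ 2| < 1 ∧
    |(t.2.2 : ℝ) - C * (t.1 : ℝ)| < 1}

theorem eventually_ramseyFilter {C D : ℝ} {P : ℕ → ℕ → ℕ → Prop}
    (h : ∀ᶠ t in ramseyFilter C D, P t.1 t.2.1 t.2.2) :
    ∃ L : ℕ, ∀ ℓ : ℕ, L ≤ ℓ → ∀ d k : ℕ, |(d : ℝ) - D ^ 2 * (ℓ : ℝ) ^ 2| < 1 →
      |(k : ℝ) - C * (ℓ : ℝ)| < 1 → P ℓ d k := by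
  rw [ramseyFilter, eventually_inf_principal, eventually_comap] at h
  obtain ⟨L, hL⟩ := eventually_atTop.1 h
  exact ⟨L, fun ℓ hℓ d k hd hk => hL ℓ hℓ (ℓ, d, k) rfl ⟨hd, hk⟩⟩

section limits

variable {C D : ℝ}

theorem ramseyFilter_mem : ∀ᶠ t in ramseyFilter C D,
    |(t.2.1 : ℝ) - D ^ 2 * (t.1 : ℝ) ^ 2| < 1 ∧ |(t.2.2 : ℝ) - C * (t.1 : ℝ)| < 1 :=
  mem_inf_of_right (mem_principal_self _)

theorem tendsto_fst_ramseyFilter : Tendsto (fun t : ℕ × ℕ × ℕ => (t.1 : ℝ)) (ramseyFilter C D) atTop :=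
  tendsto_natCast_atTop_atTop.comp (tendsto_comap.mono_left inf_le_left)

theorem tendsto_div_sqrt (hD : 0 < D) :
    Tendsto (fun t : ℕ × ℕ × ℕ => (t.1 : ℝ) / √t.2.1) (ramseyFilter C D) (𝓝 D⁻¹) := by
  have h : Tendsto (fun t : ℕ × ℕ × ℕ => √(t.2.1 : ℝ) / t.1) (ramseyFilter C D) (𝓝 D) := by
    rw [tendsto_iff_norm_sub_tendsto_zero]
    refine squeeze_zero' (Eventually.of_forall fun t => norm_nonneg _) ?_
      (tendsto_inv_atTop_zero.comp (tendsto_fst_ramseyFilter (C := C) (D := D)))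
    filter_upwards [ramseyFilter_mem, tendsto_fst_ramseyFilter.eventually_ge_atTop (D⁻¹)] with t ht hl
    have hl0 : 0 < (t.1 : ℝ) := lt_of_lt_of_le (by positivity) hl
    have hDl : 1 ≤ D * t.1 := by
      rwa [inv_le_iff_one_le_mul₀' hD] at hl
    have h1 : |√(t.2.1 : ℝ) - D * t.1| * (√(t.2.1 : ℝ) + D * t.1) < 1 := by
      have hs := Real.sqrt_nonneg (t.2.1 : ℝ)
      rw [← abs_of_nonneg (show 0 ≤ √(t.2.1 : ℝ) + D * t.1 by positivity), ← abs_mul]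
      have e : (√(t.2.1 : ℝ) - D * t.1) * (√(t.2.1 : ℝ) + D * t.1)
          = t.2.1 - D ^ 2 * (t.1 : ℝ) ^ 2 := by
        have := Real.sq_sqrt (Nat.cast_nonneg (α := ℝ) t.2.1)
        linear_combination this
      rw [e]
      exact ht.1
    have h2 : |√(t.2.1 : ℝ) - D * t.1| ≤ 1 := by
      have := Real.sqrt_nonneg (t.2.1 : ℝ)
      nlinarith [abs_nonneg (√(t.2.1 : ℝ) - D * t.1)]
    have e : √(t.2.1 : ℝ) / t.1 - D = (√(t.2.1 : ℝ) - D * t.1) * (t.1 : ℝ)⁻¹ := by field_simp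
    rw [Real.norm_eq_abs, e, abs_mul, abs_of_nonneg (show 0 ≤ (t.1 : ℝ)⁻¹ by positivity)]
    exact mul_le_of_le_one_left (by positivity) h2
  have h2 := h.inv₀ hD.ne'
  simpa [inv_div] using h2

theorem tendsto_inv_sqrt (hD : 0 < D) :
    Tendsto (fun t : ℕ × ℕ × ℕ => (√(t.2.1 : ℝ))⁻¹) (ramseyFilter C D) (𝓝 0) := by
  have h := (tendsto_div_sqrt (C := C) hD).mul
    (tendsto_inv_atTop_zero.comp (tendsto_fst_ramseyFilter (C := C) (D := D)))
  rw [mul_zero] at h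
  refine h.congr' ?_
  filter_upwards [tendsto_fst_ramseyFilter.eventually_gt_atTop 0] with t ht
  simp only [Function.comp_apply]
  field_simp

theorem tendsto_snd_div_fst :
    Tendsto (fun t : ℕ × ℕ × ℕ => (t.2.2 : ℝ) / t.1) (ramseyFilter C D) (𝓝 C) := by
  rw [tendsto_iff_norm_sub_tendsto_zero]
  refine squeeze_zero' (Eventually.of_forall fun t => norm_nonneg _) ?_
    (tendsto_inv_atTop_zero.comp (tendsto_fst_ramseyFilter (C := C) (D := D)))
  filter_upwards [ramseyFilter_mem, tendsto_fst_ramseyFilter.eventually_gt_atTop 0] with t ht hl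
  have e : (t.2.2 : ℝ) / t.1 - C = (t.2.2 - C * t.1) * (t.1 : ℝ)⁻¹ := by field_simp
  rw [Real.norm_eq_abs, e, abs_mul, abs_of_nonneg (show 0 ≤ (t.1 : ℝ)⁻¹ by positivity)]
  exact mul_le_of_le_one_left (by positivity) ht.2.le

theorem tendsto_snd_div_sqrt (hD : 0 < D) :
    Tendsto (fun t : ℕ × ℕ × ℕ => (t.2.2 : ℝ) / √t.2.1) (ramseyFilter C D) (𝓝 (C * D⁻¹)) := by
  refine (tendsto_snd_div_fst.mul (tendsto_div_sqrt (C := C) hD)).congr' ?_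
  filter_upwards [tendsto_fst_ramseyFilter.eventually_gt_atTop 0] with t ht
  field_simp

theorem tendsto_snd_ramseyFilter (hC : 1 < C) :
    Tendsto (fun t : ℕ × ℕ × ℕ => (t.2.2 : ℝ)) (ramseyFilter C D) atTop := by
  refine tendsto_atTop_mono' _ ?_ (tendsto_atTop_add_const_right _ (-1)
    (tendsto_fst_ramseyFilter (C := C) (D := D)))
  filter_upwards [ramseyFilter_mem] with t ht
  have := (abs_lt.1 ht.2).1
  have h0 : (0 : ℝ) ≤ t.1 := Nat.cast_nonneg _
  nlinarith

end limits

theorem tendsto_inv_sub_one {F : Filter (ℕ × ℕ × ℕ)} {f : ℕ × ℕ × ℕ → ℝ} (h : Tendsto f F atTop) :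
    Tendsto (fun t => (f t - 1)⁻¹) F (𝓝 0) :=
  tendsto_inv_atTop_zero.comp (tendsto_atTop_add_const_right _ (-1) h)

theorem eventually_lt_of_ratio {F : Filter (ℕ × ℕ × ℕ)} {f g : ℕ × ℕ × ℕ → ℕ} {a : ℝ} (ha : 0 < a)
    (h : Tendsto (fun t => (f t : ℝ) / √(g t)) F (𝓝 a))
    (h0 : Tendsto (fun t => (√(g t : ℝ))⁻¹) F (𝓝 0)) : ∀ᶠ t in F, f t < g t := by
  have h1 := h.mul h0
  rw [mul_zero] at h1
  filter_upwards [h1.eventually_lt_const one_pos, h.eventually_const_lt ha] with t ht ht0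
  -- If `g t = 0`, the ratio would be 0 by the convention for division, against `ht0`.
  have hg : 0 < √(g t : ℝ) := by
    rcases (Real.sqrt_nonneg (g t : ℝ)).eq_or_lt with h | h
    · rw [← h, div_zero] at ht0
      exact absurd ht0 (lt_irrefl _)
    · exact h
  rw [div_mul_eq_mul_div, ← div_eq_mul_inv, div_div, Real.mul_self_sqrt (Nat.cast_nonneg _),
    div_lt_one (Real.sqrt_pos.1 hg)] at ht
  exact_mod_cast ht

theorem exp_choose_mul_le {n : ℕ} {E x : ℝ} (hx : 0 < x) (h : E ≤ Real.log x) :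
    Real.exp (n.choose 2 * E) ≤ x ^ n.choose 2 := by
  rw [Real.exp_nat_mul]
  gcongr
  rwa [← Real.le_log_iff_exp_le hx]

/-- The hypothesis is the limit of the exponent per pair; the literal zeros are the limits of the
vanishing terms. -/
theorem eventually_probRed_le {C D θ p x : ℝ} (hD : 0 < D) (hx : 0 < x)
    (hθD : hazard θ * D⁻¹ < 1 / 2)
    (h : Real.log (gaussCDF θ) + hazard θ * (-gaussThreshold p - θ)
      - hazard θ ^ 3 * (2 * D⁻¹ - 0) / 6 + hazard θ ^ 4 * D⁻¹ ^ 2 / 2 + 0 < Real.log x) :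
    ∀ᶠ t in ramseyFilter C D, probRed t.1 t.2.1 p ≤ x ^ t.1.choose 2 := by
  obtain ⟨B, κ₀, -, hκ₀, hB⟩ := probRed_le_exp θ
  have hr := tendsto_div_sqrt (C := C) hD
  have hs := tendsto_inv_sqrt (C := C) hD
  have hl := tendsto_fst_ramseyFilter (C := C) (D := D)
  have hi := (tendsto_inv_sub_one hl).const_mul (2 * B)
  rw [mul_zero] at hi
  have hE := ((tendsto_const_nhds (x := Real.log (gaussCDF θ)
    + hazard θ * (-gaussThreshold p - θ)).sub (((hr.const_mul 2).sub hs).const_mul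
      (hazard θ ^ 3) |>.div_const 6)).add ((hr.pow 2).const_mul (hazard θ ^ 4) |>.div_const 2)).add hi
  have hs' := hs.const_mul (hazard θ)
  rw [mul_zero] at hs'
  filter_upwards [hE.eventually_le_const h, eventually_lt_of_ratio (inv_pos.2 hD) hr hs,
    hs'.eventually_le_const hκ₀, (hr.const_mul (hazard θ)).eventually_le_const hθD,
    hl.eventually_ge_atTop 2] with t h1 h2 h3 h4 h5
  exact (hB t.1 t.2.1 p (by exact_mod_cast h5) h2 h3 h4).trans (exp_choose_mul_le hx h1)

theorem eventually_probBlue_le {C D θ p x : ℝ} (hC : 1 < C) (hD : 0 < D) (hx : 0 < x)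
    (hθD : hazard θ * (C * D⁻¹) < 1 / 2)
    (h : Real.log (gaussCDF θ) + hazard θ * (gaussThreshold p - θ)
      + hazard θ ^ 3 * (2 * (C * D⁻¹) - 0) / (6 * (1 - hazard θ * (C * D⁻¹))) + 0 < Real.log x) :
    ∀ᶠ t in ramseyFilter C D, probBlue t.2.2 t.2.1 p ≤ x ^ t.2.2.choose 2 := by
  obtain ⟨B, κ₀, -, hκ₀, hB⟩ := probBlue_le_exp θ
  have hr := tendsto_snd_div_sqrt (C := C) hD
  have hs := tendsto_inv_sqrt (C := C) hD
  have hl := tendsto_snd_ramseyFilter (D := D) hC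
  have hi := (tendsto_inv_sub_one hl).const_mul (2 * B)
  rw [mul_zero] at hi
  have hE := (tendsto_const_nhds (x := Real.log (gaussCDF θ)
    + hazard θ * (gaussThreshold p - θ)).add ((((hr.const_mul 2).sub hs).const_mul
      (hazard θ ^ 3)).div (((hr.const_mul (hazard θ)).const_sub 1).const_mul 6)
        (by linarith))).add hi
  have hs' := hs.const_mul (hazard θ)
  rw [mul_zero] at hs'
  filter_upwards [hE.eventually_le_const h,
    eventually_lt_of_ratio (by positivity) hr hs,
    hs'.eventually_le_const hκ₀, (hr.const_mul (hazard θ)).eventually_le_const hθD,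
    hl.eventually_ge_atTop 2] with t h1 h2 h3 h4 h5
  exact (hB t.2.2 t.2.1 p (by exact_mod_cast h5) h2 h3 h4).trans (exp_choose_mul_le hx h1)

end GaussRamsey

/-! ### Choice of the threshold shift and of the gain -/

theorem lemma3 (C : ℝ) (hC : 1 < C) :
    ∃ D₀ : ℝ, 0 < D₀ ∧ ∀ D : ℝ, D₀ ≤ D →
      ∃ ε₁ p : ℝ, 0 < ε₁ ∧ ε₁ < GaussRamsey.erdosProb C ∧ 0 < p ∧ p < 1 / 2 ∧
        ∃ L : ℕ, ∀ ℓ : ℕ, L ≤ ℓ → ∀ d k : ℕ,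
          |(d : ℝ) - D ^ 2 * (ℓ : ℝ) ^ 2| < 1 → |(k : ℝ) - C * (ℓ : ℝ)| < 1 →
            GaussRamsey.probRed ℓ d p ≤ (GaussRamsey.erdosProb C - ε₁) ^ ℓ.choose 2 ∧
            GaussRamsey.probBlue k d p ≤
              (1 - GaussRamsey.erdosProb C - ε₁) ^ k.choose 2 := by
  open GaussRamsey in
  have hq := erdosProb_spec hC
  set q := erdosProb C with hqdef
  obtain ⟨hq0, hq1, -⟩ := id hq
  obtain ⟨hc0, hcq⟩ := gaussThreshold_spec hq0 hq1
  set c := gaussThreshold q with hcdef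
  have hΦr : gaussCDF (-c) = q := hcq
  have hΦb : gaussCDF c = 1 - q := by
    have := gaussCDF_neg c
    linarith
  set a := hazard (-c) with ha
  set b := hazard c with hb
  have ha0 : 0 < a := hazard_pos _
  have hb0 : 0 < b := hazard_pos _
  have hab : a * q = b * (1 - q) := by
    have := hazard_mul c
    rwa [hΦr, hΦb] at this
  have hgain : C * b ^ 2 < a ^ 2 := by
    have h1 := erdosProb_sq_lt hq
    have h2 : C * b ^ 2 * (1 - q) ^ 2 < a ^ 2 * (1 - q) ^ 2 := by
      calc C * b ^ 2 * (1 - q) ^ 2 = a ^ 2 * (C * q ^ 2) := by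
            rw [mul_assoc, ← mul_pow, ← hab]
            ring
        _ < a ^ 2 * (1 - q) ^ 2 := by gcongr
    exact lt_of_mul_lt_mul_right h2 (sq_nonneg _)
  set g := (a ^ 2 - C * b ^ 2) / 6 with hg
  have hg0 : 0 < g := by
    rw [hg]
    linarith
  -- The midpoint of the admissible interval from `C * b ^ 2 / 3` to `a ^ 2 / 3`, at distance `g`
  -- from either end.
  set η := C * b ^ 2 / 3 + g with hη
  have hη0 : 0 < η := by positivity
  have hηa : η = a ^ 2 / 3 - g := by
    rw [hη, hg]
    ring
  -- The summands respectively control the second-order red term, control the blue denominator, keep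
  -- the shifted threshold positive, and keep `hazard θ * n / √d` below 1/2 in the limit for each
  -- colour.
  refine ⟨a ^ 3 / g + b * C * η / g + η / c + 2 * a + 2 * (b * C), by positivity, fun D hD => ?_⟩
  have p1 : 0 < a ^ 3 / g := by positivity
  have p2 : 0 < b * C * η / g := by positivity
  have p3 : 0 < η / c := by positivity
  have p4 : 0 < b * C := by positivity
  have hD0 : 0 < D := by linarith
  have hD1 : a ^ 3 * D⁻¹ < g := by
    have : a ^ 3 / g < D := by linarith
    rw [div_lt_iff₀ hg0] at this
    rw [← div_eq_mul_inv, div_lt_iff₀ hD0]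
    linarith
  have hD2 : b * (C * D⁻¹) * η < g := by
    have : b * C * η / g < D := by linarith
    rw [div_lt_iff₀ hg0] at this
    rw [show b * (C * D⁻¹) * η = b * C * η / D by field_simp, div_lt_iff₀ hD0]
    linarith
  have hD3 : η * D⁻¹ < c := by
    have : η / c < D := by linarith
    rw [div_lt_iff₀ hc0] at this
    rw [← div_eq_mul_inv, div_lt_iff₀ hD0]
    linarith
  have hD4 : a * D⁻¹ < 1 / 2 := by
    rw [← div_eq_mul_inv, div_lt_iff₀ hD0]
    linarith
  have hD5 : b * (C * D⁻¹) < 1 / 2 := by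
    rw [show b * (C * D⁻¹) = b * C / D by field_simp, div_lt_iff₀ hD0]
    linarith
  obtain ⟨hp0, hp1, hpc⟩ := gaussThreshold_gaussCDF (c := c - η * D⁻¹) (by linarith)
  set p := gaussCDF (-(c - η * D⁻¹)) with hp
  set i := D⁻¹ with hi
  have hi0 : 0 < i := inv_pos.2 hD0
  set Er := Real.log (gaussCDF (-c)) + a * (-gaussThreshold p - -c)
      - a ^ 3 * (2 * i - 0) / 6 + a ^ 4 * i ^ 2 / 2 + 0 with hEr
  set Eb := Real.log (gaussCDF c) + b * (gaussThreshold p - c)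
      + b ^ 3 * (2 * (C * i) - 0) / (6 * (1 - b * (C * i))) + 0 with hEb
  have hEr1 : Er < Real.log q := by
    have : Er = Real.log q - a * i * (g - a ^ 3 * i / 2) := by
      rw [hEr, hpc, hΦr, hηa]
      ring
    have h2 : 0 < a * i * (g - a ^ 3 * i / 2) := by
      have : 0 < a ^ 3 * i := by positivity
      apply mul_pos (by positivity)
      linarith
    linarith
  have hEb1 : Eb < Real.log (1 - q) := by
    have hu : 0 < 1 - b * (C * i) := by linarith
    have e : Eb = Real.log (1 - q) - b * i * (η - C * b ^ 2 / 3 / (1 - b * (C * i))) := by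
      rw [hEb, hpc, hΦb]
      field_simp
      ring
    have h2 : C * b ^ 2 / 3 / (1 - b * (C * i)) < η := by
      rw [div_lt_iff₀ hu]
      have : C * b ^ 2 / 3 = η - g := by rw [hη]; ring
      linarith
    have h3 : 0 < b * i * (η - C * b ^ 2 / 3 / (1 - b * (C * i))) :=
      mul_pos (by positivity) (by linarith)
    linarith
  have hq1' : 0 < 1 - q := by linarith
  rw [Real.lt_log_iff_exp_lt hq0] at hEr1
  rw [Real.lt_log_iff_exp_lt hq1'] at hEb1
  have hr0 := Real.exp_pos Er
  have hb0' := Real.exp_pos Eb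
  -- Half of each gap, so that both limiting exponents stay strictly below the logarithms of the new
  -- bases.
  set ε := min ((q - Real.exp Er) / 2) ((1 - q - Real.exp Eb) / 2) with hε
  have hε0 : 0 < ε := lt_min (by linarith) (by linarith)
  have hε1 : ε ≤ (q - Real.exp Er) / 2 := min_le_left _ _
  have hε2 : ε ≤ (1 - q - Real.exp Eb) / 2 := min_le_right _ _
  refine ⟨ε, p, hε0, by linarith, hp0, hp1, ?_⟩
  have hred := eventually_probRed_le (C := C) (D := D) (θ := -c) (p := p) (x := q - ε) hD0
    (by linarith) hD4 (by rw [Real.lt_log_iff_exp_lt (by linarith)]; linarith)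
  have hblue := eventually_probBlue_le (C := C) (D := D) (θ := c) (p := p) (x := 1 - q - ε) hC hD0
    (by linarith) hD5 (by rw [Real.lt_log_iff_exp_lt (by linarith)]; linarith)
  exact eventually_ramseyFilter (P := fun ℓ d k => probRed ℓ d p ≤ (q - ε) ^ ℓ.choose 2 ∧
    probBlue k d p ≤ (1 - q - ε) ^ k.choose 2) (hred.and hblue)
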